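/- Let $\mathbb{S}^3\subset\mathbb{H}$ be the unit quaternions and write tangent vectors of $\mathbb{S}^3\times\mathbb{S}^3$ at $(p,q)$ as pairs $Z=(U,V)\in\mathbb{H}\times\mathbb{H}$. The nearly Kähler $\mathbb{S}^3\times\mathbb{S}^3$ carries the almost complex structure $$J(U,V)=\tfrac{1}{\sqrt3}\bigl(2pq^{-1}V-U,\,-2qp^{-1}U+V\bigr),$$ the metric $g(Z,Z')=\tfrac12\bigl(\langle Z,Z'\rangle+\langle JZ,JZ'\rangle\bigr)$, where $\langle\cdot,\cdot\rangle$ is the Euclidean product metric, and the almost product structure $P(U,V)=(pq^{-1}V,\,qp^{-1}U)$. Let $M$ be a smooth $3$-manifold and $f\colon M\to\mathbb{S}^3\times\mathbb{S}^3$ a smooth Lagrangian immersion, i.e. $J$ maps vectors tangent to $M$ to vectors that are $g$-orthogonal to $M$. Angles of $M$ at a point $x$ are real numbers $\theta_1,\theta_2,\theta_3$ for which there is a $g$-orthonormal basis $e_1,e_2,e_3$ of $T_xM$ (identified with $f_*T_xM$) with $$Pe_i=\cos(2\theta_i)\,e_i+\sin(2\theta_i)\,Je_i,\qquad i=1,2,3.$$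 Let $\theta_1,\theta_2,\theta_3$ be real-valued functions on $M$ which are angles of $M$ at every point of a dense subset $D\subset M$. If there are $i\neq j$ such that $\theta_i=\theta_j$ modulo $\pi$ at every point of $D$, then $f$ is totally geodesic: its second fundamental form $h$ with respect to the Levi-Civita connection of $g$ vanishes identically on $M$. -/

import Mathlib

open scoped Manifold ContDiff

noncomputable section

namespace NearlyKahler

/-- The four-dimensional real inner product space of quaternions contains `S³` as unit sphere. -/
instance factFinrankQuaternion : Fact (Module.finrank ℝ (Quaternion ℝ) = 3 + 1) :=
  ⟨Quaternion.finrank_eq_four⟩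

/-- `S³`, the unit quaternions, with Mathlib's manifold structure. -/
abbrev S3 : Type := Metric.sphere (0 : Quaternion ℝ) 1

/-- The manifold `S³ × S³`. -/
abbrev S3xS3 : Type := S3 × S3

/-- The ambient space `ℍ × ℍ` of `S³ × S³`. Tangent vectors to `S³ × S³` are written, as usual,
as pairs `(U, V)` of quaternions. -/
abbrev HxH : Type := Quaternion ℝ × Quaternion ℝ

/-- The inclusion `S³ × S³ ⊂ ℍ × ℍ`. -/
def incl (x : S3xS3) : HxH := ((x.1 : Quaternion ℝ), (x.2 : Quaternion ℝ))

/-- `(U, V)` is tangent to `S³ × S³` at `(p, q)`: `U ⟂ p` and `V ⟂ q`. -/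
def IsTangent (x : S3xS3) (Z : HxH) : Prop :=
  inner ℝ (x.1 : Quaternion ℝ) Z.1 = 0 ∧ inner ℝ (x.2 : Quaternion ℝ) Z.2 = 0

/-- The Euclidean product metric `⟨Z, Z'⟩ = ⟨U, U'⟩ + ⟨V, V'⟩`. -/
def eucl (Z Z' : HxH) : ℝ := inner ℝ Z.1 Z'.1 + inner ℝ Z.2 Z'.2

/-- The almost complex structure
`J(U, V) = (1/√3) (2 p q⁻¹ V - U, -2 q p⁻¹ U + V)` at `(p, q)`. -/
def J (x : S3xS3) : HxH →ₗ[ℝ] HxH where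
  toFun Z := (1 / √3 : ℝ) •
    ((2 : ℝ) • ((x.1 : Quaternion ℝ) * (x.2 : Quaternion ℝ)⁻¹ * Z.2) - Z.1,
     (-2 : ℝ) • ((x.2 : Quaternion ℝ) * (x.1 : Quaternion ℝ)⁻¹ * Z.1) + Z.2)
  map_add' Z Z' := by
    ext1 <;> simp only [Prod.fst_add, Prod.snd_add, Prod.smul_mk, mul_add, smul_add, smul_sub] <;>
      abel
  map_smul' c Z := by
    ext1 <;> simp only [Prod.smul_fst, Prod.smul_snd, Prod.smul_mk, mul_smul_comm,
      RingHom.id_apply] <;> module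

/-- The almost product structure `P(U, V) = (p q⁻¹ V, q p⁻¹ U)` at `(p, q)`. -/
def P (x : S3xS3) : HxH →ₗ[ℝ] HxH where
  toFun Z := ((x.1 : Quaternion ℝ) * (x.2 : Quaternion ℝ)⁻¹ * Z.2,
    (x.2 : Quaternion ℝ) * (x.1 : Quaternion ℝ)⁻¹ * Z.1)
  map_add' Z Z' := by simp [mul_add]
  map_smul' c Z := by simp

/-- The nearly Kähler metric: the Hermitian metric
`g(Z, Z') = (⟨Z, Z'⟩ + ⟨J Z, J Z'⟩) / 2` associated to the Euclidean product metric. -/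
def g (x : S3xS3) : LinearMap.BilinForm ℝ HxH :=
  LinearMap.mk₂ ℝ (fun Z Z' => (1 / 2 : ℝ) * (eucl Z Z' + eucl (J x Z) (J x Z')))
    (by intros; simp [eucl, inner_add_left]; ring)
    (by intros; simp [eucl, inner_smul_left]; ring)
    (by intros; simp [eucl, inner_add_right]; ring)
    (by intros; simp [eucl, inner_smul_right]; ring)

theorem g_apply (x : S3xS3) (Z Z' : HxH) :
    g x Z Z' = (1 / 2 : ℝ) * (eucl Z Z' + eucl (J x Z) (J x Z')) := rfl

theorem g_comm (x : S3xS3) (Z Z' : HxH) : g x Z Z' = g x Z' Z := by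
  simp only [g_apply, eucl, real_inner_comm]

theorem g_pos (x : S3xS3) {Z : HxH} (hZ : Z ≠ 0) : 0 < g x Z Z := by
  have h : 0 < eucl Z Z := by
    simp only [eucl, real_inner_self_eq_norm_sq]
    by_contra hn
    have h1 : Z.1 = 0 := by
      rw [← norm_eq_zero, ← sq_eq_zero_iff]
      nlinarith [sq_nonneg ‖Z.1‖, sq_nonneg ‖Z.2‖]
    have h2 : Z.2 = 0 := by
      rw [← norm_eq_zero, ← sq_eq_zero_iff]
      nlinarith [sq_nonneg ‖Z.1‖, sq_nonneg ‖Z.2‖]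
    exact hZ (Prod.ext h1 h2)
  have h' : 0 ≤ eucl (J x Z) (J x Z) :=
    add_nonneg real_inner_self_nonneg real_inner_self_nonneg
  rw [g_apply]
  linarith

theorem isCompl_orthogonal (x : S3xS3) (T : Submodule ℝ HxH) :
    IsCompl ((g x).orthogonal T) T := by
  refine IsCompl.symm ?_
  rw [LinearMap.BilinForm.isCompl_orthogonal_iff_disjoint
    (fun a b h => by rw [g_comm]; exact h), Submodule.disjoint_def]
  intro Z hZ hZ'
  by_contra hne
  exact absurd (hZ' Z hZ) (g_pos x hne).ne'

/-- The commutator product `a × b = (ab - ba) / 2` of quaternions. -/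
def cross (a b : Quaternion ℝ) : Quaternion ℝ := (1 / 2 : ℝ) • (a * b - b * a)

theorem inner_eq_coord (a b : Quaternion ℝ) : inner ℝ a b
    = a.re * b.re + a.imI * b.imI + a.imJ * b.imJ + a.imK * b.imK := by
  simp [Quaternion.inner_def]

theorem inner_mul_mul (a b c : Quaternion ℝ) :
    (inner ℝ (a * b) (a * c) : ℝ) = inner ℝ a a * inner ℝ b c := by
  simp only [inner_eq_coord, Quaternion.re_mul, Quaternion.imI_mul, Quaternion.imJ_mul,
    Quaternion.imK_mul]; ring

theorem inner_mul_star (a b c : Quaternion ℝ) :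
    (inner ℝ (a * b) c : ℝ) = inner ℝ b (star a * c) := by
  simp [inner_eq_coord]; ring

theorem inner_coe_self (p : S3) : (inner ℝ (p : Quaternion ℝ) (p : Quaternion ℝ) : ℝ) = 1 := by
  rw [real_inner_self_eq_norm_sq, norm_eq_of_mem_sphere]; norm_num

theorem coe_inv (p : S3) : (p : Quaternion ℝ)⁻¹ = star (p : Quaternion ℝ) := by
  have h : Quaternion.normSq (p : Quaternion ℝ) = 1 := by
    rw [← Quaternion.inner_self, inner_coe_self]
  rw [Quaternion.inv_def, h]; simp

theorem star_mul_coe (p : S3) : star (p : Quaternion ℝ) * (p : Quaternion ℝ) = 1 := by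
  have h : Quaternion.normSq (p : Quaternion ℝ) = 1 := by
    rw [← Quaternion.inner_self, inner_coe_self]
  rw [Quaternion.star_mul_self, h]; simp

/-- The second expression for the nearly Kähler metric. -/
theorem g_eq (x : S3xS3) (Z Z' : HxH) : g x Z Z' = (4 / 3 : ℝ) * eucl Z Z'
    - (2 / 3 : ℝ) * (inner ℝ (star (x.1 : Quaternion ℝ) * Z.1) (star (x.2 : Quaternion ℝ) * Z'.2)
      + inner ℝ (star (x.1 : Quaternion ℝ) * Z'.1) (star (x.2 : Quaternion ℝ) * Z.2)) := by
  obtain ⟨p, q⟩ := x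
  obtain ⟨U, V⟩ := Z
  obtain ⟨U', V'⟩ := Z'
  have hp := inner_coe_self p
  have hq := inner_coe_self q
  have hs : (1 / √3 : ℝ) * (1 / √3) = 1 / 3 := by
    rw [div_mul_div_comm, Real.mul_self_sqrt (by norm_num)]; norm_num
  have key : ∀ (p q : S3) (a b : Quaternion ℝ), (inner ℝ ((p : Quaternion ℝ) * star (q : Quaternion ℝ) * a)
      ((p : Quaternion ℝ) * star (q : Quaternion ℝ) * b) : ℝ) = inner ℝ a b := by
    intro p q a b
    rw [mul_assoc, mul_assoc, inner_mul_mul, inner_mul_mul, inner_coe_self]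
    have : (inner ℝ (star (q : Quaternion ℝ)) (star (q : Quaternion ℝ)) : ℝ) = 1 := by
      have h := inner_coe_self q
      simp only [inner_eq_coord, Quaternion.re_star, Quaternion.imI_star, Quaternion.imJ_star,
        Quaternion.imK_star] at h ⊢
      linarith
    rw [this]; ring
  have key2 : ∀ (p q : S3) (a b : Quaternion ℝ), (inner ℝ ((p : Quaternion ℝ) * star (q : Quaternion ℝ) * a)
      b : ℝ) = inner ℝ (star (q : Quaternion ℝ) * a) (star (p : Quaternion ℝ) * b) := by
    intro p q a b
    rw [mul_assoc, inner_mul_star]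
  have key3 : ∀ (p q : S3) (a b : Quaternion ℝ), (inner ℝ b ((p : Quaternion ℝ) * star (q : Quaternion ℝ) * a)
      : ℝ) = inner ℝ (star (p : Quaternion ℝ) * b) (star (q : Quaternion ℝ) * a) := by
    intro p q a b
    rw [real_inner_comm, key2, real_inner_comm]
  have hJ : (J (p, q)) (U, V) = ((1 / √3 : ℝ) • ((2 : ℝ) • ((p : Quaternion ℝ) * star (q : Quaternion ℝ) * V) - U),
     (1 / √3 : ℝ) • ((-2 : ℝ) • ((q : Quaternion ℝ) * star (p : Quaternion ℝ) * U) + V)) := by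
    rw [← coe_inv, ← coe_inv]; rfl
  have hJ' : (J (p, q)) (U', V') = ((1 / √3 : ℝ) • ((2 : ℝ) • ((p : Quaternion ℝ) * star (q : Quaternion ℝ) * V') - U'),
     (1 / √3 : ℝ) • ((-2 : ℝ) • ((q : Quaternion ℝ) * star (p : Quaternion ℝ) * U') + V')) := by
    rw [← coe_inv, ← coe_inv]; rfl
  rw [g_apply, hJ, hJ']
  generalize (1 / √3 : ℝ) = s at hs
  simp only [eucl,
    inner_smul_left, inner_smul_right, inner_add_left, inner_add_right, inner_sub_left,
    inner_sub_right, key, conj_trivial]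
  simp only [key2, key3]
  rw [real_inner_comm (star (p : Quaternion ℝ) * U') (star (q : Quaternion ℝ) * V)]
  linear_combination (1/2 * (5 * (inner ℝ U U' + inner ℝ V V')) -
   2 * (inner ℝ (star (p : Quaternion ℝ) * U) (star (q : Quaternion ℝ) * V') +
    inner ℝ (star (p : Quaternion ℝ) * U') (star (q : Quaternion ℝ) * V))) * hs

theorem contMDiff_incl : ContMDiff ((𝓡 3).prod (𝓡 3)) 𝓘(ℝ, HxH) ∞ incl :=
  (contMDiff_coe_sphere.comp contMDiff_fst).prodMk_space (contMDiff_coe_sphere.comp contMDiff_snd)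

section LieBracket

variable {E : Type*} [NormedAddCommGroup E] [NormedSpace ℝ E]
    {H : Type*} [TopologicalSpace H]
    {I : ModelWithCorners ℝ E H} {M : Type*} [TopologicalSpace M] [ChartedSpace H M]
    {F : Type*} [NormedAddCommGroup F] [NormedSpace ℝ F]

theorem fderivWithin_mpullbackWithin [CompleteSpace E] [IsManifold I 1 M] {u : M → F} {x : M} {z : E}
    (hz : z ∈ (extChartAt I x).target)
    (hu : MDifferentiableAt I 𝓘(ℝ, F) u ((extChartAt I x).symm z))
    (X : (y : M) → TangentSpace I y) :
    fderivWithin ℝ (u ∘ (extChartAt I x).symm) (Set.range I) z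
      (VectorField.mpullbackWithin 𝓘(ℝ, E) I (extChartAt I x).symm X (Set.range I) z)
      = mvfderiv I u ((extChartAt I x).symm z) (X ((extChartAt I x).symm z)) := by
  have hd : MDifferentiableWithinAt 𝓘(ℝ, E) I (extChartAt I x).symm (Set.range I) z :=
    mdifferentiableWithinAt_extChartAt_symm hz
  have hzr : z ∈ Set.range I := extChartAt_target_subset_range x hz
  have hinv := isInvertible_mfderivWithin_extChartAt_symm (I := I) hz
  have hc := mfderiv_comp_mfderivWithin z hu hd (I.uniqueMDiffOn z hzr)
  rw [mfderivWithin_eq_fderivWithin] at hc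
  have h2 := congrArg (fun L => L (VectorField.mpullbackWithin 𝓘(ℝ, E) I (extChartAt I x).symm X
    (Set.range I) z)) hc
  refine h2.trans ?_
  have h3 : mfderivWithin 𝓘(ℝ, E) I (extChartAt I x).symm (Set.range I) z
      (VectorField.mpullbackWithin 𝓘(ℝ, E) I (extChartAt I x).symm X (Set.range I) z)
      = X ((extChartAt I x).symm z) := by
    rw [VectorField.mpullbackWithin_apply]
    exact hinv.self_apply_inverse _
  exact congrArg (mfderiv I 𝓘(ℝ, F) u ((extChartAt I x).symm z)) h3

/-- For a smooth vector-valued `φ`: `dφ([X, Y]) = X(dφ(Y)) - Y(dφ(X))`. -/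
theorem mvfderiv_mlieBracket [CompleteSpace E]
    [IsManifold I ∞ M]
    {φ : M → F} (hφ : ContMDiff I 𝓘(ℝ, F) ∞ φ) {X Y : (y : M) → TangentSpace I y} {x : M}
    (hX : MDifferentiableAt I I.tangent (fun y => (⟨y, X y⟩ : TangentBundle I M)) x)
    (hY : MDifferentiableAt I I.tangent (fun y => (⟨y, Y y⟩ : TangentBundle I M)) x) :
    mvfderiv I φ x (VectorField.mlieBracket I X Y x)
      = mvfderiv I (fun y => mvfderiv I φ y (Y y)) x (X x)
        - mvfderiv I (fun y => mvfderiv I φ y (X y)) x (Y x) := by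
  have : IsManifold I 1 M := IsManifold.of_le (n := ∞) (by simp)
  have : IsManifold I 2 M := IsManifold.of_le (n := ∞) (WithTop.coe_le_coe.2 (OrderTop.le_top (2 : ℕ∞)))
  set e := extChartAt I x with he
  have hz0 : e x ∈ e.target := mem_extChartAt_target x
  have hz0r : e x ∈ Set.range I := extChartAt_target_subset_range x hz0
  have hsymm : e.symm (e x) = x := extChartAt_to_inv x
  have hφd : ∀ y, MDifferentiableAt I 𝓘(ℝ, F) φ y := fun y =>
    (hφ y).mdifferentiableAt (by simp)
  have hφc : ContDiffWithinAt ℝ ∞ (φ ∘ e.symm) (Set.range I) (e x) := by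
    have := (contMDiffAt_iff.1 (hφ x)).2
    simpa only [extChartAt_model_space_eq_id, PartialEquiv.refl_coe, Function.id_comp] using this
  have hVd : ∀ {V : (y : M) → TangentSpace I y},
      MDifferentiableAt I I.tangent (fun y => (⟨y, V y⟩ : TangentBundle I M)) x →
      DifferentiableWithinAt ℝ (VectorField.mpullbackWithin 𝓘(ℝ, E) I e.symm V (Set.range I))
        (Set.range I) (e x) := by
    intro V hV
    have := MDifferentiableWithinAt.differentiableWithinAt_mpullbackWithin_vectorField
      (s := Set.univ) hV.mdifferentiableWithinAt
    simpa only [Set.preimage_univ, Set.univ_inter] using this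
  -- the function `y ↦ dφ (V y)` in the chart
  have hψ : ∀ {V : (y : M) → TangentSpace I y},
      MDifferentiableAt I I.tangent (fun y => (⟨y, V y⟩ : TangentBundle I M)) x →
      DifferentiableWithinAt ℝ (fun z => fderivWithin ℝ (φ ∘ e.symm) (Set.range I) z
        (VectorField.mpullbackWithin 𝓘(ℝ, E) I e.symm V (Set.range I) z)) (Set.range I) (e x) := by
    intro V hV
    refine DifferentiableWithinAt.clm_apply ?_ (hVd hV)
    exact (hφc.fderivWithin_right (m := 1) I.uniqueDiffOn (WithTop.coe_le_coe.2 (OrderTop.le_top (2 : ℕ∞)))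
      hz0r).differentiableWithinAt one_ne_zero
  have hEq : ∀ (V : (y : M) → TangentSpace I y), ∀ z ∈ e.target,
      fderivWithin ℝ (φ ∘ e.symm) (Set.range I) z
        (VectorField.mpullbackWithin 𝓘(ℝ, E) I e.symm V (Set.range I) z)
      = mvfderiv I φ (e.symm z) (V (e.symm z)) := fun V z hz =>
    fderivWithin_mpullbackWithin hz (hφd _) V
  have hEv : ∀ (V : (y : M) → TangentSpace I y),
      (fun z => fderivWithin ℝ (φ ∘ e.symm) (Set.range I) z
        (VectorField.mpullbackWithin 𝓘(ℝ, E) I e.symm V (Set.range I) z))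
      =ᶠ[nhdsWithin (e x) (Set.range I)] (fun y => mvfderiv I φ y (V y)) ∘ e.symm := by
    intro V
    filter_upwards [extChartAt_target_mem_nhdsWithin (I := I) x] with z hz
    exact hEq V z hz
  have hu : ∀ {V : (y : M) → TangentSpace I y},
      MDifferentiableAt I I.tangent (fun y => (⟨y, V y⟩ : TangentBundle I M)) x →
      MDifferentiableAt I 𝓘(ℝ, F) (fun y => mvfderiv I φ y (V y)) x := by
    intro V hV
    have hd : DifferentiableWithinAt ℝ ((fun y => mvfderiv I φ y (V y)) ∘ e.symm)
        (Set.range I) (e x) := (hψ hV).congr_of_eventuallyEq (hEv V).symm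
        ((hEv V).symm.eq_of_nhdsWithin hz0r)
    have hcomp : MDifferentiableWithinAt I 𝓘(ℝ, F)
        (((fun y => mvfderiv I φ y (V y)) ∘ e.symm) ∘ e) Set.univ x :=
      MDifferentiableWithinAt.comp x hd.mdifferentiableWithinAt
        (mdifferentiableAt_extChartAt (mem_chart_source H x)).mdifferentiableWithinAt
        (fun y _ => by simp [he, extChartAt])
    rw [mdifferentiableWithinAt_univ] at hcomp
    refine hcomp.congr_of_eventuallyEq ?_
    filter_upwards [extChartAt_source_mem_nhds (I := I) x] with y hy
    simp only [Function.comp_apply]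
    rw [(extChartAt I x).left_inv hy]
  have hder : ∀ {V : (y : M) → TangentSpace I y},
      MDifferentiableAt I I.tangent (fun y => (⟨y, V y⟩ : TangentBundle I M)) x →
      ∀ (U : (y : M) → TangentSpace I y),
      fderivWithin ℝ (fun z => fderivWithin ℝ (φ ∘ e.symm) (Set.range I) z
        (VectorField.mpullbackWithin 𝓘(ℝ, E) I e.symm V (Set.range I) z)) (Set.range I) (e x)
        (VectorField.mpullbackWithin 𝓘(ℝ, E) I e.symm U (Set.range I) (e x))
      = mvfderiv I (fun y => mvfderiv I φ y (V y)) x (U x) := by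
    intro V hV U
    rw [(hEv V).fderivWithin_eq ((hEv V).eq_of_nhdsWithin hz0r)]
    have := fderivWithin_mpullbackWithin (I := I) (x := x) (z := e x) hz0
      (u := fun y => mvfderiv I φ y (V y)) (by rw [hsymm]; exact hu hV) U
    rw [this, hsymm]
  have hmain := VectorField.fderivWithin_apply_lieBracket (n := ∞) hφc (by
      rw [minSmoothness_of_isRCLikeNormedField]
      exact WithTop.coe_le_coe.2 (OrderTop.le_top (2 : ℕ∞)))
    I.uniqueDiffOn (I.range_subset_closure_interior hz0r) hz0r (hVd hY) (hVd hX)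
  rw [hder hY X, hder hX Y] at hmain
  rw [← hmain]
  have hL : mvfderiv I φ x = fderivWithin ℝ (φ ∘ e.symm) (Set.range I) (e x) :=
    (hφd x).mfderiv
  have hlie : VectorField.mlieBracket I X Y x =
      VectorField.lieBracketWithin ℝ
        (E := E) (VectorField.mpullbackWithin 𝓘(ℝ, E) I e.symm X (Set.range I))
        (VectorField.mpullbackWithin 𝓘(ℝ, E) I e.symm Y (Set.range I)) (Set.range I) (e x) := by
    have hinv : (mfderiv I 𝓘(ℝ, E) (extChartAt I x) x).inverse = ContinuousLinearMap.id ℝ E := by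
      rw [mfderiv_extChartAt_self]
      exact ContinuousLinearMap.inverse_id
    rw [← VectorField.mlieBracketWithin_univ, VectorField.mlieBracketWithin_apply,
      Set.preimage_univ, Set.univ_inter]
    exact congrArg (fun L : E →L[ℝ] E => L _) hinv
  rw [hlie, hL]
  rfl
end LieBracket

section Connection

variable {E : Type*} [NormedAddCommGroup E] [NormedSpace ℝ E] {H : Type*} [TopologicalSpace H]
  (I : ModelWithCorners ℝ E H) {M : Type*} [TopologicalSpace M] [ChartedSpace H M]

/-- The differential `f_* : T_x M → T_{f x}(S³ × S³) ⊂ ℍ × ℍ` of a map into `S³ × S³`. -/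
def pushforward (f : M → S3xS3) (x : M) : TangentSpace I x →L[ℝ] HxH :=
  mvfderiv I (fun y => incl (f y)) x

/-- The tensor by which the Levi-Civita connection of `g` exceeds that of the Euclidean product
metric: with `(U, V) = (p α, q β)` and `(U', V') = (p γ, q δ)` it is `(p c, -q c)`, where
`c = (β × γ - α × δ) / 3`. -/
def diffTensor (x : S3xS3) (Z Z' : HxH) : HxH :=
  let p : Quaternion ℝ := x.1
  let q : Quaternion ℝ := x.2
  let c := (1 / 3 : ℝ) • (cross (q⁻¹ * Z.2) (p⁻¹ * Z'.1) - cross (p⁻¹ * Z.1) (q⁻¹ * Z'.2))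
  (p * c, -(q * c))

/-- The covariant derivative `∇̃_v W` of a vector field `W` along `f : M → S³ × S³`, for the
Levi-Civita connection `∇̃` of the nearly Kähler metric `g` on `S³ × S³`. The first two summands
are the Levi-Civita connection of the Euclidean product metric, i.e. the tangential part of the
derivative in `ℍ × ℍ`. For `f = id`, the theorems `nabla_isTangent`, `nabla_add`, `nabla_smul`,
`nabla_metric` and `nabla_torsion_free` below prove that this is an affine connection on `S³ × S³`
which is metric for `g` and torsion-free, so it is the Levi-Civita connection;
`nabla_comp` shows that on general `f` it is the pullback of this connection. -/
def nabla (f : M → S3xS3) (W : M → HxH) (x : M) (v : TangentSpace I x) : HxH :=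
  mvfderiv I W x v
    + ((inner ℝ (pushforward I f x v).1 (W x).1 : ℝ) • ((f x).1 : Quaternion ℝ),
       (inner ℝ (pushforward I f x v).2 (W x).2 : ℝ) • ((f x).2 : Quaternion ℝ))
    + diffTensor (f x) (pushforward I f x v) (W x)

variable {I} in
theorem mvfderiv_comp_apply {F G : Type*} [NormedAddCommGroup F] [NormedSpace ℝ F]
    [NormedAddCommGroup G] [NormedSpace ℝ G] {u : M → F} {Φ : F → G} {Φ' : F →L[ℝ] G} {x : M}
    (hu : MDifferentiableAt I 𝓘(ℝ, F) u x) (hΦ : HasFDerivAt Φ Φ' (u x))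
    (v : TangentSpace I x) :
    mvfderiv I (fun y => Φ (u y)) x v = Φ' (mvfderiv I u x v) := by
  have h := (hΦ.hasMFDerivAt.comp x hu.hasMFDerivAt).mfderiv
  exact congrArg (fun L => L v) h

theorem incl_fst (x : S3xS3) : (incl x).1 = (x.1 : Quaternion ℝ) := rfl
theorem incl_snd (x : S3xS3) : (incl x).2 = (x.2 : Quaternion ℝ) := rfl

theorem pushforward_isTangent {f : M → S3xS3} {x : M}
    (hf : MDifferentiableAt I 𝓘(ℝ, HxH) (fun y => incl (f y)) x) (v : TangentSpace I x) :
    IsTangent (f x) (pushforward I f x v) := by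
  have h1 := mvfderiv_comp_apply hf
    (((hasFDerivAt_fst (𝕜 := ℝ) (p := incl (f x))).inner ℝ (hasFDerivAt_fst (𝕜 := ℝ)))) v
  have h2 := mvfderiv_comp_apply hf
    (((hasFDerivAt_snd (𝕜 := ℝ) (p := incl (f x))).inner ℝ (hasFDerivAt_snd (𝕜 := ℝ)))) v
  simp only [incl_fst, incl_snd, inner_coe_self, mvfderiv_const] at h1 h2
  simp [real_inner_comm] at h1 h2
  change (0 : ℝ) = inner ℝ _ (pushforward I f x v).1 + inner ℝ _ (pushforward I f x v).1 at h1
  change (0 : ℝ) = inner ℝ _ (pushforward I f x v).2 + inner ℝ _ (pushforward I f x v).2 at h2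
  constructor <;> linarith


theorem cross_swap (a b : Quaternion ℝ) : cross a b = -cross b a := by
  unfold cross; module

theorem diffTensor_comm (x : S3xS3) (Z Z' : HxH) : diffTensor x Z Z' = diffTensor x Z' Z := by
  simp only [diffTensor]
  rw [cross_swap _ ((x.1 : Quaternion ℝ)⁻¹ * Z'.1), cross_swap _ ((x.2 : Quaternion ℝ)⁻¹ * Z'.2),
    neg_sub_neg]

theorem diffTensor_add_right (x : S3xS3) (Z W W' : HxH) :
    diffTensor x Z (W + W') = diffTensor x Z W + diffTensor x Z W' := by
  ext1 <;> simp only [diffTensor, cross, Prod.fst_add, Prod.snd_add, mul_add, add_mul, smul_add,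
    smul_sub, mul_sub, mul_smul_comm, smul_smul] <;> module

theorem diffTensor_smul_right (x : S3xS3) (Z W : HxH) (c : ℝ) :
    diffTensor x Z (c • W) = c • diffTensor x Z W := by
  ext1 <;> simp only [diffTensor, cross, Prod.smul_fst, Prod.smul_snd, smul_mul_assoc,
    smul_sub, mul_sub, mul_smul_comm, smul_smul] <;> module

/-- For `W` a vector field on `S³ × S³`, the field `W ∘ f` along `f` has derivative
`∇̃_v (W ∘ f) = ∇̃_{f_* v} W`. -/
theorem nabla_comp {f : M → S3xS3} {x : M}
    (hf : MDifferentiableAt I ((𝓡 3).prod (𝓡 3)) f x) {W : S3xS3 → HxH}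
    (hW : MDifferentiableAt ((𝓡 3).prod (𝓡 3)) 𝓘(ℝ, HxH) W (f x)) (v : TangentSpace I x) :
    nabla I f (fun y => W (f y)) x v
      = nabla ((𝓡 3).prod (𝓡 3)) id W (f x) (mfderiv I ((𝓡 3).prod (𝓡 3)) f x v) := by
  have h1 : mvfderiv I (fun y => W (f y)) x v = mvfderiv ((𝓡 3).prod (𝓡 3)) W (f x)
      (mfderiv I ((𝓡 3).prod (𝓡 3)) f x v) :=
    congrArg (fun L => L v) (mfderiv_comp x hW hf)
  have h2 : pushforward I f x v = pushforward ((𝓡 3).prod (𝓡 3)) id (f x)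
      (mfderiv I ((𝓡 3).prod (𝓡 3)) f x v) :=
    congrArg (fun L => L v) (mfderiv_comp x (g := incl)
      ((contMDiff_incl (f x)).mdifferentiableAt (by simp)) hf)
  unfold nabla
  rw [h1, h2]
  rfl

/-- `∇̃` is additive. -/
theorem nabla_add {f : M → S3xS3} {x : M} {W W' : M → HxH}
    (hW : MDifferentiableAt I 𝓘(ℝ, HxH) W x) (hW' : MDifferentiableAt I 𝓘(ℝ, HxH) W' x)
    (v : TangentSpace I x) :
    nabla I f (W + W') x v = nabla I f W x v + nabla I f W' x v := by
  simp only [nabla]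
  rw [mvfderiv_add hW hW', Pi.add_apply, diffTensor_add_right]
  ext1 <;> simp only [Prod.fst_add, Prod.snd_add, inner_add_right, _root_.add_apply] <;> module

/-- `∇̃` satisfies the Leibniz rule. -/
theorem nabla_smul {f : M → S3xS3} {x : M} {W : M → HxH} {φ : M → ℝ}
    (hW : MDifferentiableAt I 𝓘(ℝ, HxH) W x) (hφ : MDifferentiableAt I 𝓘(ℝ, ℝ) φ x)
    (v : TangentSpace I x) :
    nabla I f (φ • W) x v = φ x • nabla I f W x v + mvfderiv I φ x v • W x := by
  simp only [nabla]
  rw [mvfderiv_smul hφ hW, Pi.smul_apply', diffTensor_smul_right]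
  ext1 <;> simp [inner_smul_right] <;> module

/-- `∇̃` is torsion-free: `∇̃_X f_* Y - ∇̃_Y f_* X = f_* [X, Y]`. -/
theorem nabla_torsion_free [CompleteSpace E] [IsManifold I ∞ M] {f : M → S3xS3}
    (hf : ContMDiff I ((𝓡 3).prod (𝓡 3)) ∞ f) {X Y : (y : M) → TangentSpace I y} {x : M}
    (hX : MDifferentiableAt I I.tangent (fun y => (⟨y, X y⟩ : TangentBundle I M)) x)
    (hY : MDifferentiableAt I I.tangent (fun y => (⟨y, Y y⟩ : TangentBundle I M)) x) :
    nabla I f (fun y => pushforward I f y (Y y)) x (X x)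
      - nabla I f (fun y => pushforward I f y (X y)) x (Y x)
      = pushforward I f x (VectorField.mlieBracket I X Y x) := by
  have h := mvfderiv_mlieBracket (φ := fun y => incl (f y)) (contMDiff_incl.comp hf) hX hY
  unfold nabla
  rw [diffTensor_comm (f x) (pushforward I f x (Y x)), real_inner_comm _ (pushforward I f x (Y x)).1,
    real_inner_comm _ (pushforward I f x (Y x)).2]
  rw [show pushforward I f x (VectorField.mlieBracket I X Y x) = _ from h]
  unfold pushforward
  abel

/-- `∇̃_v W` is tangent to `S³ × S³`. -/
theorem nabla_isTangent {f : M → S3xS3} {x : M}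
    (hf : MDifferentiableAt I 𝓘(ℝ, HxH) (fun y => incl (f y)) x) {W : M → HxH}
    (hW : MDifferentiableAt I 𝓘(ℝ, HxH) W x) (hWt : ∀ y, IsTangent (f y) (W y))
    (v : TangentSpace I x) : IsTangent (f x) (nabla I f W x v) := by
  have hu : MDifferentiableAt I 𝓘(ℝ, HxH × HxH) (fun y => (incl (f y), W y)) x :=
    hf.prodMk_space hW
  have hm : mvfderiv I (fun y => (incl (f y), W y)) x v
      = (pushforward I f x v, mvfderiv I W x v) := by
    have e1 := mvfderiv_comp_apply hu (hasFDerivAt_fst (𝕜 := ℝ)) v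
    have e2 := mvfderiv_comp_apply hu (hasFDerivAt_snd (𝕜 := ℝ)) v
    exact Prod.ext e1.symm e2.symm
  have h1 := mvfderiv_comp_apply hu
    ((((hasFDerivAt_fst (𝕜 := ℝ)).comp _ hasFDerivAt_fst).inner ℝ
      ((hasFDerivAt_fst (𝕜 := ℝ)).comp _ hasFDerivAt_snd))) v
  have h2 := mvfderiv_comp_apply hu
    ((((hasFDerivAt_snd (𝕜 := ℝ)).comp _ hasFDerivAt_fst).inner ℝ
      ((hasFDerivAt_snd (𝕜 := ℝ)).comp _ hasFDerivAt_snd))) v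
  rw [hm] at h1 h2
  simp only [Function.comp_apply, incl_fst, incl_snd, (hWt _).1, (hWt _).2, mvfderiv_const] at h1 h2
  simp at h1 h2
  have hc : ∀ (p : S3) (a b : Quaternion ℝ),
      (inner ℝ (p : Quaternion ℝ) ((p : Quaternion ℝ) * cross a b) : ℝ) = 0 := by
    intro p a b
    have h := inner_mul_mul (p : Quaternion ℝ) 1 (cross a b)
    rw [mul_one] at h
    rw [h]
    simp only [inner_eq_coord, cross, Quaternion.re_smul, Quaternion.re_sub, Quaternion.re_mul, Quaternion.imI_one, Quaternion.imJ_one, Quaternion.imK_one, smul_eq_mul]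
    ring
  constructor
  · simp only [nabla, diffTensor, Prod.fst_add, inner_add_right, inner_smul_right, inner_coe_self,
      mul_smul_comm, mul_sub, inner_sub_right, hc]
    linarith
  · simp only [nabla, diffTensor, Prod.snd_add, inner_add_right, inner_smul_right, inner_coe_self,
      mul_smul_comm, mul_sub, inner_neg_right, inner_sub_right, hc]
    linarith

/-- The metric identity behind `nabla_metric`, for the part of `∇̃` of order zero. -/
theorem metric_aux (x : S3xS3) {Z W W' : HxH} (hZ : IsTangent x Z) (hW : IsTangent x W)
    (hW' : IsTangent x W') :
    -(2 / 3 : ℝ) * (inner ℝ (star Z.1 * W.1) (star (x.2 : Quaternion ℝ) * W'.2)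
      + inner ℝ (star (x.1 : Quaternion ℝ) * W.1) (star Z.2 * W'.2)
      + inner ℝ (star Z.1 * W'.1) (star (x.2 : Quaternion ℝ) * W.2)
      + inner ℝ (star (x.1 : Quaternion ℝ) * W'.1) (star Z.2 * W.2))
    = g x (((inner ℝ Z.1 W.1 : ℝ) • (x.1 : Quaternion ℝ), (inner ℝ Z.2 W.2 : ℝ) • (x.2 : Quaternion ℝ))
        + diffTensor x Z W) W'
      + g x W (((inner ℝ Z.1 W'.1 : ℝ) • (x.1 : Quaternion ℝ),
        (inner ℝ Z.2 W'.2 : ℝ) • (x.2 : Quaternion ℝ)) + diffTensor x Z W') := by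
  have hrep : ∀ (p : S3) (a : Quaternion ℝ), inner ℝ (p : Quaternion ℝ) a = (0 : ℝ) →
      ∃ b : Quaternion ℝ, b.re = 0 ∧ a = (p : Quaternion ℝ) * b := by
    intro p a h
    have ha : a = (p : Quaternion ℝ) * (star (p : Quaternion ℝ) * a) := by
      rw [← coe_inv, mul_inv_cancel_left₀ (ne_zero_of_mem_unit_sphere p)]
    refine ⟨star (p : Quaternion ℝ) * a, ?_, ha⟩
    refine Eq.trans ?_ h
    simp only [inner_eq_coord, Quaternion.re_mul, Quaternion.re_star, Quaternion.imI_star,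
      Quaternion.imJ_star, Quaternion.imK_star]
    ring
  obtain ⟨p, q⟩ := x
  obtain ⟨a, ha, ha'⟩ := hrep p _ hZ.1
  obtain ⟨b, hb, hb'⟩ := hrep q _ hZ.2
  obtain ⟨c, hc, hc'⟩ := hrep p _ hW.1
  obtain ⟨d, hd, hd'⟩ := hrep q _ hW.2
  obtain ⟨u, hu, hu'⟩ := hrep p _ hW'.1
  obtain ⟨v, hv, hv'⟩ := hrep q _ hW'.2
  have hcan : ∀ (p : S3) (a : Quaternion ℝ), star (p : Quaternion ℝ) * ((p : Quaternion ℝ) * a) = a := by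
    intro p a
    rw [← mul_assoc, star_mul_coe, one_mul]
  have hcan2 : ∀ (p : S3) (a b : Quaternion ℝ),
      star ((p : Quaternion ℝ) * a) * ((p : Quaternion ℝ) * b) = star a * b := by
    intro p a b
    rw [star_mul, mul_assoc, hcan]
  have hin : ∀ (p : S3) (a b : Quaternion ℝ),
      (inner ℝ ((p : Quaternion ℝ) * a) ((p : Quaternion ℝ) * b) : ℝ) = inner ℝ a b := by
    intro p a b
    rw [inner_mul_mul, inner_coe_self, one_mul]
  have hin1 : ∀ (p : S3) (b : Quaternion ℝ),
      (inner ℝ ((p : Quaternion ℝ)) ((p : Quaternion ℝ) * b) : ℝ) = b.re := by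
    intro p b
    have h := inner_mul_mul (p : Quaternion ℝ) 1 b
    rw [mul_one, inner_coe_self, one_mul] at h
    rw [h]
    simp only [inner_eq_coord, Quaternion.re_one, Quaternion.imI_one, Quaternion.imJ_one,
      Quaternion.imK_one]
    ring
  have hin2 : ∀ (p : S3) (b : Quaternion ℝ),
      (inner ℝ ((p : Quaternion ℝ) * b) (p : Quaternion ℝ) : ℝ) = b.re := by
    intro p b
    rw [real_inner_comm, hin1]
  simp only [g_eq, eucl, diffTensor, coe_inv, ha', hb', hc', hd', hu', hv', hcan, hcan2, hin, hin1,
    hin2, Prod.fst_add, Prod.snd_add, mul_add, mul_neg, inner_add_left, inner_add_right,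
    mul_smul_comm, star_mul_coe, inner_neg_left, inner_neg_right, inner_smul_left,
    inner_smul_right, conj_trivial]
  simp only [inner_eq_coord, cross, Quaternion.re_smul, Quaternion.imI_smul, Quaternion.imJ_smul,
    Quaternion.imK_smul, Quaternion.re_sub, Quaternion.imI_sub, Quaternion.imJ_sub,
    Quaternion.imK_sub, Quaternion.re_mul, Quaternion.imI_mul, Quaternion.imJ_mul,
    Quaternion.imK_mul, Quaternion.re_star, Quaternion.imI_star, Quaternion.imJ_star,
    Quaternion.imK_star, Quaternion.re_one, Quaternion.imI_one, Quaternion.imJ_one,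
    Quaternion.imK_one, smul_eq_mul, ha, hb, hc, hd, hu, hv]
  ring

/-- Quaternion conjugation as a continuous linear map. -/
def starL : Quaternion ℝ →L[ℝ] Quaternion ℝ :=
  LinearMap.toContinuousLinearMap
    { toFun := star, map_add' := star_add, map_smul' := fun c a => by simp }

/-- `∇̃` is metric for `g`: `v(g(W, W')) = g(∇̃_v W, W') + g(W, ∇̃_v W')`. -/
theorem nabla_metric {f : M → S3xS3} {x : M}
    (hf : MDifferentiableAt I 𝓘(ℝ, HxH) (fun y => incl (f y)) x) {W W' : M → HxH}
    (hW : MDifferentiableAt I 𝓘(ℝ, HxH) W x) (hW' : MDifferentiableAt I 𝓘(ℝ, HxH) W' x)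
    (hWt : IsTangent (f x) (W x)) (hWt' : IsTangent (f x) (W' x))
    (v : TangentSpace I x) :
    mvfderiv I (fun y => g (f y) (W y) (W' y)) x v
      = g (f x) (nabla I f W x v) (W' x) + g (f x) (W x) (nabla I f W' x v) := by
  have hu : MDifferentiableAt I 𝓘(ℝ, HxH × HxH × HxH) (fun y => (incl (f y), W y, W' y)) x :=
    hf.prodMk_space (hW.prodMk_space hW')
  have hm : mvfderiv I (fun y => (incl (f y), W y, W' y)) x v
      = (pushforward I f x v, mvfderiv I W x v, mvfderiv I W' x v) := by
    have e1 := mvfderiv_comp_apply hu (hasFDerivAt_fst (𝕜 := ℝ)) v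
    have e2 := mvfderiv_comp_apply hu
      ((hasFDerivAt_fst (𝕜 := ℝ)).comp _ (hasFDerivAt_snd (𝕜 := ℝ))) v
    have e3 := mvfderiv_comp_apply hu
      ((hasFDerivAt_snd (𝕜 := ℝ)).comp _ (hasFDerivAt_snd (𝕜 := ℝ))) v
    exact Prod.ext e1.symm (Prod.ext e2.symm e3.symm)
  have ha : HasFDerivAt (fun z : HxH × HxH × HxH => z.1) _ (incl (f x), W x, W' x) :=
    hasFDerivAt_fst (𝕜 := ℝ)
  have hw : HasFDerivAt (fun z : HxH × HxH × HxH => z.2.1) _ (incl (f x), W x, W' x) :=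
    (hasFDerivAt_fst (𝕜 := ℝ)).comp _ (hasFDerivAt_snd (𝕜 := ℝ))
  have hw' : HasFDerivAt (fun z : HxH × HxH × HxH => z.2.2) _ (incl (f x), W x, W' x) :=
    (hasFDerivAt_snd (𝕜 := ℝ)).comp _ (hasFDerivAt_snd (𝕜 := ℝ))
  have hsa : HasFDerivAt (fun z : HxH × HxH × HxH => star z.1.1) _ (incl (f x), W x, W' x) :=
    starL.hasFDerivAt.comp _ ha.fst
  have hsb : HasFDerivAt (fun z : HxH × HxH × HxH => star z.1.2) _ (incl (f x), W x, W' x) :=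
    starL.hasFDerivAt.comp _ ha.snd
  have hΦ := ((((hw.fst).inner ℝ hw'.fst).add ((hw.snd).inner ℝ hw'.snd)).const_mul (4 / 3 : ℝ)).sub
    ((((hsa.mul' hw.fst).inner ℝ (hsb.mul' hw'.snd)).add
      ((hsa.mul' hw'.fst).inner ℝ (hsb.mul' hw.snd))).const_mul (2 / 3 : ℝ))
  have h := mvfderiv_comp_apply hu hΦ v
  rw [hm] at h
  have hg : (fun y => g (f y) (W y) (W' y)) = _ := funext fun y => g_eq (f y) (W y) (W' y)
  rw [hg]
  refine h.trans ?_
  have haux := metric_aux (f x) (pushforward_isTangent I hf v) hWt hWt'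
  have hn : ∀ V : M → HxH, nabla I f V x v = mvfderiv I V x v +
    (((inner ℝ (pushforward I f x v).1 (V x).1 : ℝ) • ((f x).1 : Quaternion ℝ),
       (inner ℝ (pushforward I f x v).2 (V x).2 : ℝ) • ((f x).2 : Quaternion ℝ))
      + diffTensor (f x) (pushforward I f x v) (V x)) := fun V => add_assoc _ _ _
  have hadd : ∀ Z₁ Z₂ Z₃ : HxH, g (f x) (Z₁ + Z₂) Z₃ = g (f x) Z₁ Z₃ + g (f x) Z₂ Z₃ :=
    fun Z₁ Z₂ Z₃ => by rw [map_add]; rfl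
  have hadd' : ∀ Z₁ Z₂ Z₃ : HxH, g (f x) Z₃ (Z₁ + Z₂) = g (f x) Z₃ Z₁ + g (f x) Z₃ Z₂ :=
    fun Z₁ Z₂ Z₃ => map_add _ _ _
  rw [hn W, hn W', hadd, hadd', add_add_add_comm, ← haux, g_eq, g_eq]
  simp [eucl, incl, starL, inner_add_left, inner_add_right]
  ring

/-- The projection of `ℍ × ℍ` onto the `g`-orthogonal complement of the tangent space
`f_* T_x M`. On `T_{f x}(S³ × S³)` this is the projection onto the normal space. -/
def normalProj (f : M → S3xS3) (x : M) : HxH →ₗ[ℝ] HxH :=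
  Submodule.projection _ _
    (isCompl_orthogonal (f x) (LinearMap.range (pushforward I f x : TangentSpace I x →ₗ[ℝ] HxH)))

/-- The second fundamental form `h(v, Y)` at `x`, defined by the Gauss formula: the normal part of
`∇̃_v (f_* Y)`, for a tangent vector `v` at `x` and a vector field `Y` on `M`. -/
def secondFundamentalForm (f : M → S3xS3) (x : M) (v : TangentSpace I x)
    (Y : (y : M) → TangentSpace I y) : HxH :=
  normalProj I f x (nabla I f (fun y => pushforward I f y (Y y)) x v)

/-- `h(v, Y) = 0` if and only if `∇̃_v (f_* Y)` is tangent to the submanifold. -/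
theorem secondFundamentalForm_eq_zero_iff (f : M → S3xS3) (x : M) (v : TangentSpace I x)
    (Y : (y : M) → TangentSpace I y) : secondFundamentalForm I f x v Y = 0 ↔
      ∃ w : TangentSpace I x,
        pushforward I f x w = nabla I f (fun y => pushforward I f y (Y y)) x v := by
  unfold secondFundamentalForm normalProj
  rw [Submodule.projection_apply_eq_zero_iff]
  exact LinearMap.mem_range

end Connection

section Lagrangian

variable {M : Type*} [TopologicalSpace M] [ChartedSpace (EuclideanSpace ℝ (Fin 3)) M]

/-- The immersion `f` is totally geodesic: its second fundamental form vanishes, i.e.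
`h(v, Y) = 0` for every tangent vector `v` and every vector field `Y` that is smooth near the
base point of `v`. -/
def IsTotallyGeodesic [IsManifold (𝓡 3) ∞ M] (f : M → S3xS3) : Prop :=
  ∀ (x : M) (v : TangentSpace (𝓡 3) x) (Y : (y : M) → TangentSpace (𝓡 3) y),
    ContMDiffAt (𝓡 3) (𝓡 3).tangent ∞ (fun y => (⟨y, Y y⟩ : TangentBundle (𝓡 3) M)) x →
    secondFundamentalForm (𝓡 3) f x v Y = 0

/-- A smooth immersion `f` of a 3-dimensional manifold (half the dimension of `S³ × S³`) is a
Lagrangian submanifold of the nearly Kähler `S³ × S³` if `J` maps tangent vectors to normal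
vectors. -/
structure IsLagrangianImmersion (f : M → S3xS3) : Prop where
  smooth : ContMDiff (𝓡 3) ((𝓡 3).prod (𝓡 3)) ∞ f
  immersion : ∀ x, Function.Injective (mfderiv (𝓡 3) ((𝓡 3).prod (𝓡 3)) f x)
  lagrangian : ∀ (x : M) (v w : TangentSpace (𝓡 3) x),
    g (f x) (J (f x) (pushforward (𝓡 3) f x v)) (pushforward (𝓡 3) f x w) = 0

/-- `θ₁, θ₂, θ₃` are angles of `f` at the point `x`: there is a `g`-orthonormal basis
`e₁, e₂, e₃` of the tangent space with `P eᵢ = cos 2θᵢ eᵢ + sin 2θᵢ J eᵢ`. -/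
def AreAnglesAt (f : M → S3xS3) (x : M) (θ : Fin 3 → ℝ) : Prop :=
  ∃ e : Fin 3 → TangentSpace (𝓡 3) x,
    (∀ i j, g (f x) (pushforward (𝓡 3) f x (e i)) (pushforward (𝓡 3) f x (e j))
      = if i = j then 1 else 0) ∧
    ∀ i, P (f x) (pushforward (𝓡 3) f x (e i))
      = Real.cos (2 * θ i) • pushforward (𝓡 3) f x (e i)
        + Real.sin (2 * θ i) • J (f x) (pushforward (𝓡 3) f x (e i))

end Lagrangian

end NearlyKahler

end

/-! Left translation identifies every tangent space of S³ × S³ with ℂ³ in such a way that `J` is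
multiplication by i, `P` is complex conjugation and g is the real part of the Hermitian product
(`leftC_J`, `leftC_P`, `g_eq_herm`). In a chart the immersion becomes a ℂ³-valued one-form ζ that is
isotropic and torsion-free with respect to the Christoffel tensor `gam` (`IsLagrangianForm`), and h
becomes the trilinear form `sff`.

Differentiating isotropy and inserting the structure equation shows that the complex determinant is
real on tangent spaces (`im_tri`). Hence `sff` is totally symmetric, the numbers mᵢ = exp(2iθᵢ) have
product 1, and, after one more derivative, `sff` is trace-free (`im_trace`).

Let S and g be the pullbacks of the complex bilinear and of the Hermitian product. The eigenvalues
of S relative to g are the conjugates of the mᵢ. If the first two agree, with common value W, then S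
- W g has rank at most one. Differentiating this (`sff_of_pencil`) leaves a single unknown t = h₀₀₂
= h₁₁₂, with h₂₂₂ = -2t and all other components zero; moreover dW kills e₀ and e₁, and dW(e₂) =
2iWt. It remains to see that t = 0.

If the third eigenvalue is different and dW ≠ 0, the planes spanned by e₀ and e₁ are the kernels of
dW and would be integrable; but the bracket of these directions has an e₂-component that is a
nonzero multiple of the determinant (`pencil_commutator`). So dW = 0 and t = 0
(`sff_eq_zero_of_ne`). If all three eigenvalues agree near the point, S = W g gives dW(e₂) = 2iW
h₂₂₂ as well, so t = -2t (`sff_eq_zero_of_scalar`). Continuity of `sff` and density of D combine the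
two cases (`sff_eq_zero`).

Neither the angles nor the frames are assumed to be continuous, and they are only given on D.
Therefore W is expressed through the smooth components of S and g, frames are used one point at a
time, and whatever has to be differentiated is stated as an identity that extends from D to an open
set. -/

noncomputable section

namespace NearlyKahler

/-! ### Multilinear algebra of ℂ³. -/

/-- `ℂ³`, the model of the tangent spaces of `S³ × S³`. -/
abbrev C3 : Type := Fin 3 → ℂ

/-- The complex bilinear product of `ℂ³`. -/
def bil (z w : C3) : ℂ := z 0 * w 0 + z 1 * w 1 + z 2 * w 2

/-- The complex conjugate of a vector of `ℂ³`. -/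
def conj3 (z : C3) : C3 := fun k => starRingEnd ℂ (z k)

/-- The Hermitian product of `ℂ³`, linear in the first variable. -/
def herm (z w : C3) : ℂ := bil z (conj3 w)

/-- The complex bilinear cross product of `ℂ³`. -/
def crs (z w : C3) : C3 :=
  ![z 1 * w 2 - z 2 * w 1, z 2 * w 0 - z 0 * w 2, z 0 * w 1 - z 1 * w 0]

/-- The complex determinant on `ℂ³`. -/
def tri (x y z : C3) : ℂ := bil (crs x y) z

/-- The Christoffel tensor of the nearly Kähler metric in the left-invariant frame. -/
def gam (z w : C3) : C3 :=
  ((1 / (2 * √3) : ℝ) : ℂ) • ((2 : ℂ) • crs z w + (2 : ℂ) • crs (conj3 z) w - crs (conj3 z) (conj3 w))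

theorem bil_comm (z w : C3) : bil z w = bil w z := by simp only [bil]; ring

theorem bil_add_left (z z' w : C3) : bil (z + z') w = bil z w + bil z' w := by
  simp only [bil, Pi.add_apply]; ring

theorem bil_sub_left (z z' w : C3) : bil (z - z') w = bil z w - bil z' w := by
  simp only [bil, Pi.sub_apply]; ring

theorem bil_smul_left (c : ℂ) (z w : C3) : bil (c • z) w = c * bil z w := by
  simp only [bil, Pi.smul_apply, smul_eq_mul]; ring

theorem bil_smul_right (c : ℂ) (z w : C3) : bil z (c • w) = c * bil z w := by
  simp only [bil, Pi.smul_apply, smul_eq_mul]; ring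

theorem herm_add_left (z z' w : C3) : herm (z + z') w = herm z w + herm z' w := bil_add_left _ _ _

theorem herm_sub_left (z z' w : C3) : herm (z - z') w = herm z w - herm z' w := bil_sub_left _ _ _

theorem herm_smul_left (c : ℂ) (z w : C3) : herm (c • z) w = c * herm z w := bil_smul_left _ _ _

theorem conj3_conj3 (z : C3) : conj3 (conj3 z) = z := by
  ext k; simp [conj3]

theorem conj_bil (z w : C3) : starRingEnd ℂ (bil z w) = bil (conj3 z) (conj3 w) := by
  simp [bil, conj3]

theorem conj_herm (z w : C3) : starRingEnd ℂ (herm z w) = herm w z := by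
  rw [herm, conj_bil, conj3_conj3, bil_comm]; rfl

theorem conj_tri (x y z : C3) : starRingEnd ℂ (tri x y z) = tri (conj3 x) (conj3 y) (conj3 z) := by
  simp [tri, bil, conj3, crs]

theorem tri_smul (a b c : ℂ) (x y z : C3) :
    tri (a • x) (b • y) (c • z) = a * b * c * tri x y z := by
  simp [tri, bil, crs]; ring

/-- The Gram determinant. -/
theorem tri_mul_tri (a b c x y z : C3) : tri a b c * tri x y z
    = bil a x * (bil b y * bil c z - bil b z * bil c y)
      - bil a y * (bil b x * bil c z - bil b z * bil c x)
      + bil a z * (bil b x * bil c y - bil b y * bil c x) := by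
  simp [tri, bil, crs]; ring

theorem herm_gam (x y z : C3) : herm (gam x y) z = ((1 / (2 * √3) : ℝ) : ℂ) *
    (2 * tri x y (conj3 z) + 2 * tri (conj3 x) y (conj3 z)
      - tri (conj3 x) (conj3 y) (conj3 z)) := by
  simp only [gam, herm_smul_left, herm_add_left, herm_sub_left]; rfl

theorem tri_swap12 (x y z : C3) : tri y x z = -tri x y z := by
  simp [tri, bil, crs]; ring

theorem tri_rotate (x y z : C3) : tri y z x = tri x y z := by
  simp [tri, bil, crs]; ring

theorem im_mul_real (r : ℝ) (z : ℂ) : ((r : ℂ) * z).im = r * z.im := by simp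

/-- The cyclic sum of the torsion of the left-invariant frame. -/
theorem im_cyclic_gam (x y z : C3) :
    (herm (gam x y - gam y x) z).im + (herm (gam y z - gam z y) x).im
      + (herm (gam z x - gam x z) y).im = √3 * (tri x y z).im := by
  have hs : √3 * √3 = (3 : ℝ) := Real.mul_self_sqrt (by norm_num)
  have h3 : √3 ≠ 0 := by positivity
  simp only [herm_sub_left, herm_gam, Complex.sub_im, im_mul_real, tri, bil, crs, conj3]
  simp
  field_simp
  have : √3 ^ 2 = (3 : ℝ) := by rw [sq, hs]
  rw [this]
  ring

/-- Total symmetry of the imaginary part of `gam`, given that the determinant is real. -/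
theorem im_herm_gam_swap (x y z : C3) (h : (tri x y z).im = 0) :
    (herm (gam x y) z).im = (herm (gam x z) y).im := by
  simp only [herm_gam, im_mul_real]
  congr 1
  have h2 : (starRingEnd ℂ (tri x y z)).im = 0 := by simp [h]
  simp only [tri, bil, crs, conj3] at h2 ⊢
  simp at h2 ⊢
  linear_combination (-2) * h2

/-! ### Product rules along curves. -/

section Curves

theorem hasDerivAt_apply {z : ℝ → C3} {z' : C3} {s : ℝ} (h : HasDerivAt z z' s) (k : Fin 3) :
    HasDerivAt (fun t => z t k) (z' k) s := hasDerivAt_pi.1 h k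

theorem hasDerivAt_bil_curve {z w : ℝ → C3} {z' w' : C3} {s : ℝ} (hz : HasDerivAt z z' s)
    (hw : HasDerivAt w w' s) :
    HasDerivAt (fun t => bil (z t) (w t)) (bil z' (w s) + bil (z s) w') s := by
  have h := fun k => (hasDerivAt_apply hz k).mul (hasDerivAt_apply hw k)
  refine (((h 0).add (h 1)).add (h 2)).congr_deriv ?_
  simp only [bil]; ring

theorem hasDerivAt_conj3_curve {z : ℝ → C3} {z' : C3} {s : ℝ} (hz : HasDerivAt z z' s) :
    HasDerivAt (fun t => conj3 (z t)) (conj3 z') s :=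
  hasDerivAt_pi.2 fun k =>
    (Complex.conjCLE.toContinuousLinearMap.hasFDerivAt).comp_hasDerivAt s (hasDerivAt_apply hz k)

theorem hasDerivAt_herm_curve {z w : ℝ → C3} {z' w' : C3} {s : ℝ} (hz : HasDerivAt z z' s)
    (hw : HasDerivAt w w' s) :
    HasDerivAt (fun t => herm (z t) (w t)) (herm z' (w s) + herm (z s) w') s :=
  hasDerivAt_bil_curve hz (hasDerivAt_conj3_curve hw)

theorem hasDerivAt_crs_curve {z w : ℝ → C3} {z' w' : C3} {s : ℝ} (hz : HasDerivAt z z' s)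
    (hw : HasDerivAt w w' s) :
    HasDerivAt (fun t => crs (z t) (w t)) (crs z' (w s) + crs (z s) w') s := by
  have h := fun k l => (hasDerivAt_apply hz k).mul (hasDerivAt_apply hw l)
  refine hasDerivAt_pi.2 fun k => ?_
  fin_cases k
  · refine ((h 1 2).sub (h 2 1)).congr_deriv ?_
    simp [crs]; ring
  · refine ((h 2 0).sub (h 0 2)).congr_deriv ?_
    simp [crs]; ring
  · refine ((h 0 1).sub (h 1 0)).congr_deriv ?_
    simp [crs]; ring

theorem hasDerivAt_tri_curve {x y z : ℝ → C3} {x' y' z' : C3} {s : ℝ} (hx : HasDerivAt x x' s)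
    (hy : HasDerivAt y y' s) (hz : HasDerivAt z z' s) :
    HasDerivAt (fun t => tri (x t) (y t) (z t))
      (tri x' (y s) (z s) + tri (x s) y' (z s) + tri (x s) (y s) z') s := by
  refine (hasDerivAt_bil_curve (hasDerivAt_crs_curve hx hy) hz).congr_deriv ?_
  simp only [tri, bil_add_left]

theorem im_eq_zero_of_hasDerivAt {φ : ℝ → ℂ} {φ' : ℂ} {s : ℝ} (h : HasDerivAt φ φ' s)
    (h0 : ∀ᶠ t in nhds s, (φ t).im = 0) : φ'.im = 0 := by
  have h1 : HasDerivAt (fun t => (φ t).im) φ'.im s :=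
    (Complex.imCLM.hasFDerivAt).comp_hasDerivAt s h
  have h2 : HasDerivAt (fun t => (φ t).im) 0 s :=
    (hasDerivAt_const s (0 : ℝ)).congr_of_eventuallyEq h0
  exact h1.unique h2

theorem eq_of_hasDerivAt {φ ψ : ℝ → ℂ} {φ' ψ' : ℂ} {s : ℝ} (h : HasDerivAt φ φ' s)
    (h' : HasDerivAt ψ ψ' s) (h0 : ∀ᶠ t in nhds s, φ t = ψ t) : φ' = ψ' :=
  h.unique (h'.congr_of_eventuallyEq h0)

end Curves

/-! ### Lagrangian one-forms: constant phase and symmetry of the second fundamental form. -/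

section Forms

variable {E : Type*} [NormedAddCommGroup E] [NormedSpace ℝ E]

theorem eventually_line {p : E → Prop} {x : E} (h : ∀ᶠ y in nhds x, p y) (u : E) :
    ∀ᶠ s : ℝ in nhds 0, p (x + s • u) := by
  have hc : Continuous fun s : ℝ => x + s • u := by fun_prop
  have := hc.tendsto 0
  simp only [zero_smul, add_zero] at this
  exact this.eventually h

theorem hasDerivAt_line {F : Type*} [NormedAddCommGroup F] [NormedSpace ℝ F] {φ : E → F} {x : E}
    (h : DifferentiableAt ℝ φ x) (u : E) :
    HasDerivAt (fun s : ℝ => φ (x + s • u)) (fderiv ℝ φ x u) 0 :=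
  h.hasFDerivAt.hasLineDerivAt u

/-- A Lagrangian immersion in the left-invariant frame: the smooth `ℂ³`-valued one-form `ζ` on the
open set `U` is isotropic and satisfies the structure equation of `S³ × S³`. -/
structure IsLagrangianForm (U : Set E) (ζ : E → E →L[ℝ] C3) : Prop where
  isOpen : IsOpen U
  smooth : ContDiffOn ℝ ∞ ζ U
  isotropic : ∀ x ∈ U, ∀ v w, (herm (ζ x v) (ζ x w)).im = 0
  torsion : ∀ x ∈ U, ∀ u v, fderiv ℝ ζ x u v + gam (ζ x u) (ζ x v)
    = fderiv ℝ ζ x v u + gam (ζ x v) (ζ x u)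

/-- The second fundamental form in the left-invariant frame, as a trilinear form. -/
def sff (ζ : E → E →L[ℝ] C3) (x u v w : E) : ℝ :=
  (herm (fderiv ℝ ζ x u v + gam (ζ x u) (ζ x v)) (ζ x w)).im

namespace IsLagrangianForm

variable {U : Set E} {ζ : E → E →L[ℝ] C3} (h : IsLagrangianForm U ζ) {x : E}
include h

theorem contDiffAt (hx : x ∈ U) : ContDiffAt ℝ ∞ ζ x :=
  h.smooth.contDiffAt (h.isOpen.mem_nhds hx)

theorem hasDerivAt (hx : x ∈ U) (u v : E) :
    HasDerivAt (fun s : ℝ => ζ (x + s • u) v) (fderiv ℝ ζ x u v) 0 := by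
  have h1 := hasDerivAt_line ((h.contDiffAt hx).differentiableAt (by simp)) u
  exact (((ContinuousLinearMap.apply ℝ C3 v).hasFDerivAt).comp_hasDerivAt (0 : ℝ) h1)

theorem hasDerivAt_bil (hx : x ∈ U) (u v w : E) :
    HasDerivAt (fun s : ℝ => bil (ζ (x + s • u) v) (ζ (x + s • u) w))
      (bil (fderiv ℝ ζ x u v) (ζ x w) + bil (ζ x v) (fderiv ℝ ζ x u w)) 0 := by
  have := hasDerivAt_bil_curve (h.hasDerivAt hx u v) (h.hasDerivAt hx u w)
  simpa only [zero_smul, add_zero] using this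

theorem hasDerivAt_herm (hx : x ∈ U) (u v w : E) :
    HasDerivAt (fun s : ℝ => herm (ζ (x + s • u) v) (ζ (x + s • u) w))
      (herm (fderiv ℝ ζ x u v) (ζ x w) + herm (ζ x v) (fderiv ℝ ζ x u w)) 0 := by
  have := hasDerivAt_herm_curve (h.hasDerivAt hx u v) (h.hasDerivAt hx u w)
  simpa only [zero_smul, add_zero] using this

theorem hasDerivAt_tri (hx : x ∈ U) (u a b c : E) :
    HasDerivAt (fun s : ℝ => tri (ζ (x + s • u) a) (ζ (x + s • u) b) (ζ (x + s • u) c))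
      (tri (fderiv ℝ ζ x u a) (ζ x b) (ζ x c) + tri (ζ x a) (fderiv ℝ ζ x u b) (ζ x c)
        + tri (ζ x a) (ζ x b) (fderiv ℝ ζ x u c)) 0 := by
  have := hasDerivAt_tri_curve (h.hasDerivAt hx u a) (h.hasDerivAt hx u b) (h.hasDerivAt hx u c)
  simpa only [zero_smul, add_zero] using this

theorem im_herm_fderiv_swap (hx : x ∈ U) (u v w : E) :
    (herm (fderiv ℝ ζ x u v) (ζ x w)).im = (herm (fderiv ℝ ζ x u w) (ζ x v)).im := by
  have h1 := im_eq_zero_of_hasDerivAt (h.hasDerivAt_herm hx u v w)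
    (eventually_line (Filter.eventually_of_mem (h.isOpen.mem_nhds hx)
      fun y hy => h.isotropic y hy v w) u)
  rw [← conj_herm (fderiv ℝ ζ x u w)] at h1
  simp at h1
  linarith

/-- Isotropy makes Im⟨(D_u ζ)v, ζw⟩ symmetric in v and w, so the cyclic sum of its
antisymmetrisation in u and v cancels. By the structure equation that sum is also the one of
`im_cyclic_gam`, which is √3 times the imaginary part of the determinant. Geometrically, a
Lagrangian immersion automatically has constant phase. -/
theorem im_tri (hx : x ∈ U) (u v w : E) : (tri (ζ x u) (ζ x v) (ζ x w)).im = 0 := by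
  have h1 := im_cyclic_gam (ζ x u) (ζ x v) (ζ x w)
  have h2 : ∀ a b, gam (ζ x a) (ζ x b) - gam (ζ x b) (ζ x a)
      = fderiv ℝ ζ x b a - fderiv ℝ ζ x a b := fun a b => by
    have := h.torsion x hx a b
    rw [sub_eq_sub_iff_add_eq_add, add_comm, this, add_comm]
  rw [h2, h2, h2] at h1
  simp only [herm_sub_left, Complex.sub_im] at h1
  rw [h.im_herm_fderiv_swap hx u v w, h.im_herm_fderiv_swap hx v u w,
    h.im_herm_fderiv_swap hx w u v] at h1
  have h3 : √3 * (tri (ζ x u) (ζ x v) (ζ x w)).im = 0 := by rw [← h1]; ring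
  exact (mul_eq_zero.1 h3).resolve_left (by positivity)

theorem sff_swap12 (hx : x ∈ U) (u v w : E) : sff ζ x u v w = sff ζ x v u w := by
  rw [sff, h.torsion x hx, sff]

/-- The derivative term is symmetric by isotropy and the `gam` term because the determinant is real.
Together with `sff_swap12` this is total symmetry. -/
theorem sff_swap23 (hx : x ∈ U) (u v w : E) : sff ζ x u v w = sff ζ x u w v := by
  simp only [sff, herm_add_left, Complex.add_im]
  rw [h.im_herm_fderiv_swap hx, im_herm_gam_swap _ _ _ (h.im_tri hx u v w)]

theorem im_tri_fderiv (hx : x ∈ U) (u a b c : E) :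
    (tri (fderiv ℝ ζ x u a) (ζ x b) (ζ x c) + tri (ζ x a) (fderiv ℝ ζ x u b) (ζ x c)
        + tri (ζ x a) (ζ x b) (fderiv ℝ ζ x u c)).im = 0 :=
  im_eq_zero_of_hasDerivAt (h.hasDerivAt_tri hx u a b c)
    (eventually_line (Filter.eventually_of_mem (h.isOpen.mem_nhds hx)
      fun _ hy => h.im_tri hy a b c) u)

end IsLagrangianForm

theorem herm_add_right (z w w' : C3) : herm z (w + w') = herm z w + herm z w' := by
  rw [← conj_herm, herm_add_left, map_add, conj_herm, conj_herm]

theorem herm_smul_right (c : ℝ) (z w : C3) : herm z (c • w) = c * herm z w := by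
  simp [herm, bil, conj3]; ring

theorem sff_add_right (ζ : E → E →L[ℝ] C3) (x u v w w' : E) :
    sff ζ x u v (w + w') = sff ζ x u v w + sff ζ x u v w' := by
  simp only [sff, map_add, herm_add_right, Complex.add_im]

theorem sff_smul_right (ζ : E → E →L[ℝ] C3) (x u v w : E) (c : ℝ) :
    sff ζ x u v (c • w) = c * sff ζ x u v w := by
  simp only [sff, map_smul, herm_smul_right, im_mul_real]

/-! ### Frames of angles at a single point. -/

theorem herm_eq_of_conj3_eq {z w : C3} {m : ℂ} (hw : conj3 w = m • w) : herm z w = m * bil z w := by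
  rw [herm, hw, bil_smul_right]

/-- An orthonormal frame of angles, in the left-invariant frame: complex conjugation acts on the
`i`-th vector as multiplication by the unit complex number `m i`. -/
structure IsAngleFrame (L : E →L[ℝ] C3) (e : Fin 3 → E) (m : Fin 3 → ℂ) : Prop where
  orth : ∀ i j, herm (L (e i)) (L (e j)) = if i = j then 1 else 0
  eig : ∀ i, conj3 (L (e i)) = m i • L (e i)
  span : ∀ v, ∃ n : Fin 3 → ℝ, v = n 0 • e 0 + n 1 • e 1 + n 2 • e 2

namespace IsAngleFrame

variable {L : E →L[ℝ] C3} {e : Fin 3 → E} {m : Fin 3 → ℂ} (F : IsAngleFrame L e m)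
include F

/-- Conjugation preserves the Hermitian norm, so its eigenvalue has modulus one. -/
theorem conj_mul (i : Fin 3) : starRingEnd ℂ (m i) * m i = 1 := by
  have h1 := F.orth i i
  rw [if_pos rfl, herm_eq_of_conj3_eq (F.eig i)] at h1
  have h2 := congrArg (starRingEnd ℂ) h1
  rw [map_mul, conj_bil, F.eig, bil_smul_left, bil_smul_right, map_one] at h2
  linear_combination h2 - starRingEnd ℂ (m i) * m i * h1

/-- The eigenvalues of S relative to g are thus the conjugates of the `m i`; the later computations
trade `bil` for `herm` through this identity. -/
theorem bil_eq (z : C3) (i : Fin 3) :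
    bil z (L (e i)) = starRingEnd ℂ (m i) * herm z (L (e i)) := by
  rw [herm_eq_of_conj3_eq (F.eig i), ← mul_assoc, F.conj_mul, one_mul]

theorem tri_mul_conj : tri (L (e 0)) (L (e 1)) (L (e 2))
    * starRingEnd ℂ (tri (L (e 0)) (L (e 1)) (L (e 2))) = 1 := by
  rw [conj_tri, tri_mul_tri]
  have := F.orth
  simp only [herm] at this
  simp [this]

theorem tri_ne_zero : tri (L (e 0)) (L (e 1)) (L (e 2)) ≠ 0 :=
  left_ne_zero_of_mul_eq_one F.tri_mul_conj

/-- Cramer's rule in a unitary basis: replacing one column of the determinant picks out the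
coefficient along that basis vector. With its two companions it turns the derivative of the
determinant into a trace. -/
theorem tri_left (z : C3) : tri z (L (e 1)) (L (e 2))
    = herm z (L (e 0)) * tri (L (e 0)) (L (e 1)) (L (e 2)) := by
  have h1 := tri_mul_tri z (L (e 1)) (L (e 2)) (conj3 (L (e 0))) (conj3 (L (e 1))) (conj3 (L (e 2)))
  have := F.orth
  simp only [herm] at this
  simp [this, ← conj_tri] at h1
  rw [herm, ← h1]
  linear_combination (-tri z (L (e 1)) (L (e 2))) * F.tri_mul_conj

theorem tri_mid (z : C3) : tri (L (e 0)) z (L (e 2))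
    = herm z (L (e 1)) * tri (L (e 0)) (L (e 1)) (L (e 2)) := by
  have h1 := tri_mul_tri (L (e 0)) z (L (e 2)) (conj3 (L (e 0))) (conj3 (L (e 1))) (conj3 (L (e 2)))
  have := F.orth
  simp only [herm] at this
  simp [this, ← conj_tri] at h1
  rw [herm, ← h1]
  linear_combination (-tri (L (e 0)) z (L (e 2))) * F.tri_mul_conj

theorem tri_right (z : C3) : tri (L (e 0)) (L (e 1)) z
    = herm z (L (e 2)) * tri (L (e 0)) (L (e 1)) (L (e 2)) := by
  have h1 := tri_mul_tri (L (e 0)) (L (e 1)) z (conj3 (L (e 0))) (conj3 (L (e 1))) (conj3 (L (e 2)))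
  have := F.orth
  simp only [herm] at this
  simp [this, ← conj_tri] at h1
  rw [herm, ← h1]
  linear_combination (-tri (L (e 0)) (L (e 1)) z) * F.tri_mul_conj

/-- Conjugating all three columns multiplies the determinant by the product of the `m i`; a real
determinant is fixed by conjugation, and it is nonzero. In terms of angles, their sum is 0 modulo π.
-/
theorem prod_eq_one (h : (tri (L (e 0)) (L (e 1)) (L (e 2))).im = 0) : m 0 * m 1 * m 2 = 1 := by
  have h1 := conj_tri (L (e 0)) (L (e 1)) (L (e 2))
  rw [F.eig, F.eig, F.eig, tri_smul, Complex.conj_eq_iff_im.2 h] at h1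
  exact mul_right_cancel₀ F.tri_ne_zero (by rw [← h1, one_mul])

/-- Conjugation acts on each frame vector by a scalar, so the three determinants in `herm_gam` are
multiples of a single one. -/
theorem herm_gam_eq (i j l : Fin 3) : herm (gam (L (e i)) (L (e j))) (L (e l))
    = ((1 / (2 * √3) : ℝ) : ℂ) * (2 * m l + 2 * m i * m l - m i * m j * m l)
      * tri (L (e i)) (L (e j)) (L (e l)) := by
  have h := fun a b c : ℂ => tri_smul a b c (L (e i)) (L (e j)) (L (e l))
  have h1 := h 1 1 (m l)
  have h2 := h (m i) 1 (m l)
  simp only [one_smul] at h1 h2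
  rw [herm_gam, F.eig, F.eig, F.eig, h, h1, h2]
  ring

end IsAngleFrame

/-! ### First and second order consequences of a double eigenvalue. -/

theorem tri_self12 (x z : C3) : tri x x z = 0 := by simp [tri, bil, crs]; ring
theorem tri_self23 (x z : C3) : tri x z z = 0 := by simp [tri, bil, crs]; ring

/-- The derivative in the direction `u` of the bilinear form `S - W g`, where `S` and `g` are the
pullbacks of the complex bilinear and the Hermitian product, and `W'` is the derivative of `W`. -/
def pencilDeriv (ζ : E → E →L[ℝ] C3) (x : E) (W W' : ℂ) (u v w : E) : ℂ :=
  bil (fderiv ℝ ζ x u v) (ζ x w) + bil (ζ x v) (fderiv ℝ ζ x u w)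
    - (W' * herm (ζ x v) (ζ x w)
      + W * (herm (fderiv ℝ ζ x u v) (ζ x w) + herm (ζ x v) (fderiv ℝ ζ x u w)))

namespace IsLagrangianForm

variable {U : Set E} {ζ : E → E →L[ℝ] C3} (h : IsLagrangianForm U ζ) {x : E} (hx : x ∈ U)
  {e : Fin 3 → E} {m : Fin 3 → ℂ} (F : IsAngleFrame (ζ x) e m)
include h hx F

theorem prod_eq_one : m 0 * m 1 * m 2 = 1 := F.prod_eq_one (h.im_tri hx _ _ _)

/-- This is minimality. The derivative of the determinant is the trace of the derivative times the
determinant; both determinant and derivative are real, and the determinant is nonzero. -/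
theorem im_trace (u : E) : (herm (fderiv ℝ ζ x u (e 0)) (ζ x (e 0))).im
    + (herm (fderiv ℝ ζ x u (e 1)) (ζ x (e 1))).im
    + (herm (fderiv ℝ ζ x u (e 2)) (ζ x (e 2))).im = 0 := by
  have h1 := h.im_tri_fderiv hx u (e 0) (e 1) (e 2)
  have h2 := h.im_tri hx (e 0) (e 1) (e 2)
  have h3 := F.tri_ne_zero
  rw [F.tri_left (fderiv ℝ ζ x u (e 0)), F.tri_mid (fderiv ℝ ζ x u (e 1)),
    F.tri_right (fderiv ℝ ζ x u (e 2))] at h1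
  have h4 : (tri (ζ x (e 0)) (ζ x (e 1)) (ζ x (e 2))).re ≠ 0 := fun h0 =>
    h3 (Complex.ext h0 h2)
  simp only [Complex.add_im, Complex.mul_im, h2, mul_zero, zero_add] at h1
  rw [← add_mul, ← add_mul] at h1
  exact (mul_eq_zero.1 h1).resolve_right h4

omit h hx in
theorem sff_eq_of_eq12 (i l : Fin 3) : sff ζ x (e i) (e i) (e l)
    = (herm (fderiv ℝ ζ x (e i) (e i)) (ζ x (e l))).im := by
  rw [sff, herm_add_left, F.herm_gam_eq, tri_self12]; simp

omit h hx in
theorem sff_eq_of_eq23 (i l : Fin 3) : sff ζ x (e l) (e i) (e i)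
    = (herm (fderiv ℝ ζ x (e l) (e i)) (ζ x (e i))).im := by
  rw [sff, herm_add_left, F.herm_gam_eq, tri_self23]; simp

/-- The `gam` term drops out because its coefficient is real: the product of the `m i` is 1, so m₂m₁
is the conjugate of m₀, which equals m₁. -/
theorem sff_201 (hm : m 0 = m 1) : sff ζ x (e 2) (e 0) (e 1)
    = (herm (fderiv ℝ ζ x (e 2) (e 0)) (ζ x (e 1))).im := by
  rw [sff, herm_add_left, F.herm_gam_eq, mul_assoc, Complex.add_im, im_mul_real,
    tri_rotate, tri_rotate]
  have h1 := h.prod_eq_one hx F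
  have h2 := F.conj_mul 0
  have h3 : 2 * m 1 + 2 * m 2 * m 1 - m 2 * m 0 * m 1 = (m 0 + starRingEnd ℂ (m 0)) * 2 - 1 := by
    rw [← hm] at h1 ⊢
    linear_combination (2 * starRingEnd ℂ (m 0) - 1) * h1 - 2 * m 2 * m 0 * h2
  rw [h3, Complex.mul_im, h.im_tri hx]
  simp

/-- Because both vectors have eigenvalue W, all terms cancel except W times the difference of a
Hermitian product and its conjugate, that is 2iW times the imaginary part. -/
theorem im_herm_01 (hm : m 0 = m 1) {W' : ℂ} {u : E}
    (hW : pencilDeriv ζ x (starRingEnd ℂ (m 0)) W' u (e 0) (e 1) = 0) :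
    (herm (fderiv ℝ ζ x u (e 0)) (ζ x (e 1))).im = 0 := by
  rw [h.im_herm_fderiv_swap hx]
  rw [pencilDeriv, F.bil_eq, bil_comm, F.bil_eq, F.orth, ← hm,
    ← conj_herm (fderiv ℝ ζ x u (e 1))] at hW
  have h1 : starRingEnd ℂ (m 0) ≠ 0 := left_ne_zero_of_mul_eq_one (F.conj_mul 0)
  have h2 : herm (fderiv ℝ ζ x u (e 1)) (ζ x (e 0))
      - starRingEnd ℂ (herm (fderiv ℝ ζ x u (e 1)) (ζ x (e 0))) = 0 := by
    refine (mul_eq_zero.1 ?_).resolve_left h1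
    simp at hW
    linear_combination hW
  rw [Complex.sub_conj] at h2
  simpa using h2

omit h hx in
-- The cancellation of `im_herm_01` on the diagonal. Through `sff_eq_of_eq23` it expresses the
-- derivative of an eigenvalue by a component of h.
theorem pencil_diag {W' : ℂ} {u : E} {i : Fin 3}
    (hW : pencilDeriv ζ x (starRingEnd ℂ (m i)) W' u (e i) (e i) = 0) :
    W' = 2 * starRingEnd ℂ (m i) * Complex.I
      * ((herm (fderiv ℝ ζ x u (e i)) (ζ x (e i))).im : ℂ) := by
  rw [pencilDeriv, F.bil_eq, bil_comm, F.bil_eq, F.orth, if_pos rfl,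
    ← conj_herm (fderiv ℝ ζ x u (e i))] at hW
  have h2 := Complex.sub_conj (herm (fderiv ℝ ζ x u (e i)) (ζ x (e i)))
  push_cast at h2
  linear_combination (-1) * hW + starRingEnd ℂ (m i) * h2

/-- By total symmetry the ten components with ordered indices determine all 27. -/
theorem sff_eq_zero_of_frame
    (h000 : sff ζ x (e 0) (e 0) (e 0) = 0) (h001 : sff ζ x (e 0) (e 0) (e 1) = 0)
    (h002 : sff ζ x (e 0) (e 0) (e 2) = 0) (h011 : sff ζ x (e 0) (e 1) (e 1) = 0)
    (h012 : sff ζ x (e 0) (e 1) (e 2) = 0) (h022 : sff ζ x (e 0) (e 2) (e 2) = 0)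
    (h111 : sff ζ x (e 1) (e 1) (e 1) = 0) (h112 : sff ζ x (e 1) (e 1) (e 2) = 0)
    (h122 : sff ζ x (e 1) (e 2) (e 2) = 0) (h222 : sff ζ x (e 2) (e 2) (e 2) = 0)
    (u v w : E) : sff ζ x u v w = 0 := by
  have s12 := h.sff_swap12 hx
  have s23 := h.sff_swap23 hx
  have key : ∀ a b, (∀ i, sff ζ x a b (e i) = 0) → ∀ w, sff ζ x a b w = 0 := by
    intro a b hab w
    obtain ⟨n, rfl⟩ := F.span w
    simp only [sff_add_right, sff_smul_right, hab]; ring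
  have base : ∀ i j k, sff ζ x (e i) (e j) (e k) = 0 := by
    intro i j k
    fin_cases i <;> fin_cases j <;> fin_cases k <;>
      simp only [Fin.zero_eta, Fin.mk_one, Fin.reduceFinMk] <;> grind
  have b1 : ∀ i j w, sff ζ x (e i) (e j) w = 0 := fun i j => key _ _ (base i j)
  have b2 : ∀ i v w, sff ζ x (e i) v w = 0 := fun i v w => by
    rw [s23]; exact key _ _ (fun j => by rw [s23]; exact b1 i j w) v
  rw [s12, s23]
  exact key _ _ (fun i => by rw [s23, s12]; exact b2 i v w) u

/-- The components of the second fundamental form where the first two angles agree, when the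
double eigenvalue `W` satisfies the first order conditions. -/
theorem sff_of_pencil (hm : m 0 = m 1) {W' : E → ℂ}
    (h01 : ∀ u, pencilDeriv ζ x (starRingEnd ℂ (m 0)) (W' u) u (e 0) (e 1) = 0)
    (h00 : ∀ u, pencilDeriv ζ x (starRingEnd ℂ (m 0)) (W' u) u (e 0) (e 0) = 0)
    (h11 : ∀ u, pencilDeriv ζ x (starRingEnd ℂ (m 0)) (W' u) u (e 1) (e 1) = 0) :
    W' (e 0) = 0 ∧ W' (e 1) = 0 ∧
      W' (e 2) = 2 * starRingEnd ℂ (m 0) * Complex.I * (sff ζ x (e 0) (e 0) (e 2) : ℂ) ∧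
      sff ζ x (e 2) (e 2) (e 2) = -2 * sff ζ x (e 0) (e 0) (e 2) ∧
      (sff ζ x (e 0) (e 0) (e 2) = 0 → ∀ u v w, sff ζ x u v w = 0) := by
  have s12 := h.sff_swap12 hx
  have s23 := h.sff_swap23 hx
  have d0 := fun u => pencil_diag F (h00 u)
  have d1 := fun u => pencil_diag F (i := 1) (by rw [← hm]; exact h11 u)
  have hw : starRingEnd ℂ (m 0) ≠ 0 := left_ne_zero_of_mul_eq_one (F.conj_mul 0)
  -- The two diagonal conditions compute the same number `W' u`, so h(u, e₀, e₀) = h(u, e₁, e₁).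
  have d01 : ∀ u, (herm (fderiv ℝ ζ x u (e 0)) (ζ x (e 0))).im
      = (herm (fderiv ℝ ζ x u (e 1)) (ζ x (e 1))).im := by
    intro u
    have := (d0 u).symm.trans (d1 u)
    rw [← hm] at this
    exact_mod_cast mul_left_cancel₀ (by simp [hw]) this
  have o := fun u => h.im_herm_01 hx F hm (h01 u)
  have tr := fun u => h.im_trace hx F u
  have e23 := fun i l => sff_eq_of_eq23 (ζ := ζ) F i l
  have e12 := fun i l => sff_eq_of_eq12 (ζ := ζ) F i l
  have h001 : sff ζ x (e 0) (e 0) (e 1) = 0 := by rw [e12, o]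
  have h011 : sff ζ x (e 0) (e 1) (e 1) = 0 := by
    rw [s12, s23, e12, h.im_herm_fderiv_swap hx, o]
  have h000 : sff ζ x (e 0) (e 0) (e 0) = 0 := by rw [e23, d01, ← e23, h011]
  have h100 : sff ζ x (e 1) (e 0) (e 0) = 0 := by rw [s12, s23, h001]
  have h111 : sff ζ x (e 1) (e 1) (e 1) = 0 := by rw [e23, ← d01, ← e23, h100]
  have h012 : sff ζ x (e 0) (e 1) (e 2) = 0 := by
    rw [s23, s12, h.sff_201 hx F hm, o]
  have h022 : sff ζ x (e 0) (e 2) (e 2) = 0 := by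
    have := tr (e 0); rw [← e23, ← e23, ← e23] at this; linarith
  have h122 : sff ζ x (e 1) (e 2) (e 2) = 0 := by
    have := tr (e 1); rw [← e23, ← e23, ← e23] at this; linarith
  have h200 : sff ζ x (e 2) (e 0) (e 0) = sff ζ x (e 0) (e 0) (e 2) := by rw [s12, s23]
  have h211 : sff ζ x (e 2) (e 1) (e 1) = sff ζ x (e 0) (e 0) (e 2) := by
    rw [e23, ← d01, ← e23, h200]
  have h112 : sff ζ x (e 1) (e 1) (e 2) = sff ζ x (e 0) (e 0) (e 2) := by rw [s23, s12, h211]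
  have h222 : sff ζ x (e 2) (e 2) (e 2) = -2 * sff ζ x (e 0) (e 0) (e 2) := by
    have := tr (e 2); rw [← e23, ← e23, ← e23] at this; linarith
  refine ⟨?_, ?_, ?_, h222, fun h0 => h.sff_eq_zero_of_frame hx F h000 h001 h0 h011 h012 h022 h111
    (by rw [h112, h0]) h122 (by rw [h222, h0, mul_zero])⟩
  · rw [d0, ← e23, h000]; simp
  · rw [d0, ← e23, h100]; simp
  · rw [d0, ← e23, h200]

/-- The commutator of the two directions of the double eigenvalue is transversal to them. -/
theorem pencil_commutator (hm : m 0 = m 1) {W' : E → ℂ} :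
    pencilDeriv ζ x (starRingEnd ℂ (m 0)) (W' (e 1)) (e 1) (e 0) (e 2)
      - pencilDeriv ζ x (starRingEnd ℂ (m 0)) (W' (e 0)) (e 0) (e 1) (e 2)
      = ((1 / √3 : ℝ) : ℂ) * tri (ζ x (e 0)) (ζ x (e 1)) (ζ x (e 2))
        * (starRingEnd ℂ (m 0) - starRingEnd ℂ (m 2)) := by
  set Δ := tri (ζ x (e 0)) (ζ x (e 1)) (ζ x (e 2)) with hΔ
  have hp := h.prod_eq_one hx F
  have hc := F.conj_mul 0
  have hΔr : starRingEnd ℂ Δ = Δ := Complex.conj_eq_iff_im.2 (h.im_tri hx _ _ _)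
  have ht := congrArg (fun z => herm z (ζ x (e 2))) (h.torsion x hx (e 0) (e 1))
  simp only [herm_add_left, F.herm_gam_eq] at ht
  rw [tri_swap12 (ζ x (e 0)), ← hΔ, ← hm] at ht
  -- Isotropy equates the imaginary parts of `k120` and `k102`, and of `k021` and `k012` (named
  -- below). The antisymmetrised derivative then depends only on `k102 - k012` and its conjugate.
  have i1 := h.im_herm_fderiv_swap hx (e 1) (e 2) (e 0)
  have i2 := h.im_herm_fderiv_swap hx (e 0) (e 2) (e 1)
  have c1 := Complex.sub_conj (herm (fderiv ℝ ζ x (e 1) (e 2)) (ζ x (e 0)))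
  have c2 := Complex.sub_conj (herm (fderiv ℝ ζ x (e 0) (e 2)) (ζ x (e 1)))
  rw [i1, ← Complex.sub_conj] at c1
  rw [i2, ← Complex.sub_conj] at c2
  simp only [pencilDeriv]
  rw [F.bil_eq, F.bil_eq, bil_comm (ζ x (e 0)), bil_comm (ζ x (e 1)), F.bil_eq, F.bil_eq, F.orth,
    F.orth, ← conj_herm (fderiv ℝ ζ x (e 1) (e 2)), ← conj_herm (fderiv ℝ ζ x (e 0) (e 2))]
  rw [← hm] at hp ⊢
  generalize herm (fderiv ℝ ζ x (e 1) (e 2)) (ζ x (e 0)) = k120 at *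
  generalize herm (fderiv ℝ ζ x (e 0) (e 2)) (ζ x (e 1)) = k021 at *
  generalize herm (fderiv ℝ ζ x (e 1) (e 0)) (ζ x (e 2)) = k102 at *
  generalize herm (fderiv ℝ ζ x (e 0) (e 1)) (ζ x (e 2)) = k012 at *
  have hr : ((1 / √3 : ℝ) : ℂ) = 2 * ((1 / (2 * √3) : ℝ) : ℂ) := by push_cast; ring
  rw [hr]
  have hrr : starRingEnd ℂ ((1 / (2 * √3) : ℝ) : ℂ) = ((1 / (2 * √3) : ℝ) : ℂ) :=
    Complex.conj_ofReal _
  generalize ((1 / (2 * √3) : ℝ) : ℂ) = r at *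
  have m2 : m 2 = starRingEnd ℂ (m 0) ^ 2 := by
    linear_combination starRingEnd ℂ (m 0) ^ 2 * hp
      - (starRingEnd ℂ (m 0) * m 0 + 1) * m 2 * hc
  -- The structure equation on e₀, e₁, paired with e₂, determines this difference; this is the only
  -- place where the torsion of the left-invariant frame enters.
  have hβ : k102 - k012 = 2 * r * Δ
      * (2 * starRingEnd ℂ (m 0) ^ 2 + 2 * starRingEnd ℂ (m 0) - 1) := by
    rw [m2] at ht
    linear_combination (-1) * ht + (4 * r * Δ * starRingEnd ℂ (m 0)
      - 2 * r * Δ * (starRingEnd ℂ (m 0) * m 0 + 1)) * hc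
  have hβ' := congrArg (starRingEnd ℂ) hβ
  simp only [map_mul, map_sub, map_add, map_pow, hrr, hΔr, Complex.conj_conj, map_one, map_ofNat]
    at hβ'
  have m2c : starRingEnd ℂ (m 2) = m 0 ^ 2 := by rw [m2, map_pow, Complex.conj_conj]
  rw [m2c]
  have h02 : (0 : Fin 3) ≠ 2 := by decide
  have h12 : (1 : Fin 3) ≠ 2 := by decide
  simp only [if_neg h02, if_neg h12]
  linear_combination (m 0 ^ 2 - starRingEnd ℂ (m 0)) * hβ
    + starRingEnd ℂ (m 0) * (c1 - c2 + hβ - hβ')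
    + 4 * r * Δ * (starRingEnd ℂ (m 0) * m 0) * hc

end IsLagrangianForm

/-! ### The pencil S - W g near a point, and vanishing of the second fundamental form. -/

/-- The bilinear form `S - W g`. -/
def pencil (ζ : E → E →L[ℝ] C3) (W : E → ℂ) (x : E) (v w : E) : ℂ :=
  bil (ζ x v) (ζ x w) - W x * herm (ζ x v) (ζ x w)

theorem bil_add_right (z w w' : C3) : bil z (w + w') = bil z w + bil z w' := by
  simp only [bil, Pi.add_apply]; ring

theorem real_smul_eq (c : ℝ) (z : C3) : c • z = (c : ℂ) • z := by
  ext k; simp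

namespace IsAngleFrame

variable {L : E →L[ℝ] C3} {e : Fin 3 → E} {m : Fin 3 → ℂ} (F : IsAngleFrame L e m)
include F

theorem eq_sum (v : E) : ∃ n : Fin 3 → ℝ, v = n 0 • e 0 + n 1 • e 1 + n 2 • e 2 ∧
    herm (L v) (L (e 2)) = n 2 := by
  obtain ⟨n, hn⟩ := F.span v
  refine ⟨n, hn, ?_⟩
  rw [hn]
  simp only [map_add, map_smul, real_smul_eq, herm_add_left, herm_smul_left, F.orth]
  simp

/-- S is diagonal in the frame; subtracting the double eigenvalue leaves only the square of the
covector dual to e₂. -/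
theorem pencil_eq (hm : m 0 = m 1) (v w : E) :
    bil (L v) (L w) - starRingEnd ℂ (m 0) * herm (L v) (L w)
      = (starRingEnd ℂ (m 2) - starRingEnd ℂ (m 0)) * herm (L v) (L (e 2))
        * herm (L w) (L (e 2)) := by
  obtain ⟨n, hn, hn2⟩ := F.eq_sum v
  obtain ⟨k, hk, hk2⟩ := F.eq_sum w
  have hb : ∀ i j, bil (L (e i)) (L (e j)) = starRingEnd ℂ (m j) * if i = j then 1 else 0 :=
    fun i j => by rw [F.bil_eq, F.orth]
  rw [hn2, hk2, hn, hk]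
  simp only [map_add, map_smul, herm_add_right, herm_smul_right, bil_add_right, herm_add_left]
  simp only [real_smul_eq, herm_smul_left, bil_smul_left, bil_smul_right, bil_add_left, hb, F.orth]
  simp [← hm]
  ring

end IsAngleFrame

namespace IsLagrangianForm

variable {U : Set E} {ζ : E → E →L[ℝ] C3} (h : IsLagrangianForm U ζ) {x : E}
include h

theorem conj_herm_self (hx : x ∈ U) (v w : E) :
    starRingEnd ℂ (herm (ζ x v) (ζ x w)) = herm (ζ x v) (ζ x w) :=
  Complex.conj_eq_iff_im.2 (h.isotropic x hx v w)

theorem contDiffAt_coord (hx : x ∈ U) (v : E) (k : Fin 3) :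
    ContDiffAt ℝ ∞ (fun y => ζ y v k) x :=
  contDiffAt_pi.1 ((h.contDiffAt hx).clm_apply contDiffAt_const) k

omit h in
theorem _root_.NearlyKahler.contDiffAt_conj {φ : E → ℂ} (hφ : ContDiffAt ℝ ∞ φ x) :
    ContDiffAt ℝ ∞ (fun y => starRingEnd ℂ (φ y)) x :=
  Complex.conjCLE.toContinuousLinearMap.contDiff.contDiffAt.comp x hφ

theorem contDiffAt_bil (hx : x ∈ U) (v w : E) :
    ContDiffAt ℝ ∞ (fun y => bil (ζ y v) (ζ y w)) x := by
  have c := fun v k => h.contDiffAt_coord hx v k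
  exact (((c v 0).mul (c w 0)).add ((c v 1).mul (c w 1))).add ((c v 2).mul (c w 2))

theorem contDiffAt_herm (hx : x ∈ U) (v w : E) :
    ContDiffAt ℝ ∞ (fun y => herm (ζ y v) (ζ y w)) x := by
  have c := fun v k => h.contDiffAt_coord hx v k
  have c' := fun v k => contDiffAt_conj (h.contDiffAt_coord hx v k)
  exact (((c v 0).mul (c' w 0)).add ((c v 1).mul (c' w 1))).add ((c v 2).mul (c' w 2))

theorem hasDerivAt_pencil (hx : x ∈ U) {W : E → ℂ} (hW : DifferentiableAt ℝ W x) (u v w : E) :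
    HasDerivAt (fun s : ℝ => pencil ζ W (x + s • u) v w)
      (pencilDeriv ζ x (W x) (fderiv ℝ W x u) u v w) 0 := by
  have := (h.hasDerivAt_bil hx u v w).sub ((hasDerivAt_line hW u).mul (h.hasDerivAt_herm hx u v w))
  simp only [zero_smul, add_zero] at this
  exact this

theorem continuousAt_pencil (hx : x ∈ U) {W : E → ℂ} (hW : ContDiffAt ℝ ∞ W x) (v w : E) :
    ContinuousAt (fun y => pencil ζ W y v w) x :=
  ((h.contDiffAt_bil hx v w).sub (hW.mul (h.contDiffAt_herm hx v w))).continuousAt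

omit [NormedSpace ℝ E] h in
-- Identities proved with frames at points of D become identities on an open set, where they can be
-- differentiated.
theorem _root_.NearlyKahler.eqOn_of_dense {F : Type*} [TopologicalSpace F] [T2Space F]
    {V D : Set E} (hV : IsOpen V)
    (hD : V ⊆ closure D) {φ ψ : E → F} (hφ : ContinuousOn φ V) (hψ : ContinuousOn ψ V)
    (heq : ∀ y ∈ D ∩ V, φ y = ψ y) : ∀ y ∈ V, φ y = ψ y :=
  Set.EqOn.of_subset_closure (s := D ∩ V) heq hφ hψ Set.inter_subset_right fun y hy => by
    rw [Set.inter_comm]; exact hV.inter_closure ⟨hy, hD hy⟩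

theorem continuousOn_sff (u v w : E) : ContinuousOn (fun y => sff ζ y u v w) U := by
  intro x hx
  have c : ∀ v k, ContinuousAt (fun y => ζ y v k) x := fun v k =>
    (h.contDiffAt_coord hx v k).continuousAt
  have hd : ContinuousAt (fun y => fderiv ℝ ζ y u v) x := by
    have h1 : ContDiffAt ℝ 0 (fderiv ℝ ζ) x :=
      (h.contDiffAt hx).fderiv_right (m := 0) (by simp)
    exact (h1.continuousAt.clm_apply continuousAt_const).clm_apply continuousAt_const
  have d : ∀ k, ContinuousAt (fun y => fderiv ℝ ζ y u v k) x := fun k =>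
    (continuous_apply k).continuousAt.comp hd
  have hc : Continuous (starRingEnd ℂ) := Complex.continuous_conj
  have c' : ∀ v k, ContinuousAt (fun y => starRingEnd ℂ (ζ y v k)) x := fun v k =>
    hc.continuousAt.comp (c v k)
  refine ContinuousAt.continuousWithinAt ?_
  have h0 := c u 0; have h1 := c u 1; have h2 := c u 2
  have i0 := c v 0; have i1 := c v 1; have i2 := c v 2
  have j0 := c' u 0; have j1 := c' u 1; have j2 := c' u 2
  have k0 := c' v 0; have k1 := c' v 1; have k2 := c' v 2
  have l0 := c' w 0; have l1 := c' w 1; have l2 := c' w 2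
  have m0 := d 0; have m1 := d 1; have m2 := d 2
  refine Complex.continuous_im.continuousAt.comp ?_
  simp [herm, bil, gam, crs, conj3]
  fun_prop

/-- The case in which all three angles agree near `x`. -/
theorem sff_eq_zero_of_scalar {V D : Set E} (hV : IsOpen V) (hVU : V ⊆ U) (hD : V ⊆ closure D)
    (hF : ∀ y ∈ D ∩ V, ∃ c : ℂ, ∀ v w, bil (ζ y v) (ζ y w) = c * herm (ζ y v) (ζ y w))
    (hx : x ∈ V) {e : Fin 3 → E} {m : Fin 3 → ℂ} (F : IsAngleFrame (ζ x) e m) (hm : m 0 = m 1)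
    (hm2 : m 2 = m 0) (u v w : E) : sff ζ x u v w = 0 := by
  have hG : herm (ζ x (e 0)) (ζ x (e 0)) = 1 := by rw [F.orth, if_pos rfl]
  -- The vector `e 0` is held fixed while y varies and is a unit vector only at x, hence the
  -- division by g(e₀, e₀).
  set W : E → ℂ := fun y => bil (ζ y (e 0)) (ζ y (e 0)) * (herm (ζ y (e 0)) (ζ y (e 0)))⁻¹ with hWd
  have hWx : W x = starRingEnd ℂ (m 0) := by simp [hWd, F.bil_eq, hG]
  have hWs : ContDiffAt ℝ ∞ W x :=
    (h.contDiffAt_bil (hVU hx) _ _).mul ((h.contDiffAt_herm (hVU hx) _ _).inv (by simp [hG]))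
  have hS : ∀ v w, ∀ y ∈ V, bil (ζ y v) (ζ y w) * herm (ζ y (e 0)) (ζ y (e 0))
      = bil (ζ y (e 0)) (ζ y (e 0)) * herm (ζ y v) (ζ y w) := by
    intro v w
    refine eqOn_of_dense hV hD (fun y hy => ?_) (fun y hy => ?_) fun y hy => ?_
    · exact ((h.contDiffAt_bil (hVU hy) _ _).mul
        (h.contDiffAt_herm (hVU hy) _ _)).continuousAt.continuousWithinAt
    · exact ((h.contDiffAt_bil (hVU hy) _ _).mul
        (h.contDiffAt_herm (hVU hy) _ _)).continuousAt.continuousWithinAt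
    · obtain ⟨c, hc⟩ := hF y hy
      rw [hc, hc]; ring
  have hT : ∀ u v w, pencilDeriv ζ x (starRingEnd ℂ (m 0)) (fderiv ℝ W x u) u v w = 0 := by
    intro u v w
    rw [← hWx]
    refine eq_of_hasDerivAt (h.hasDerivAt_pencil (hVU hx) (hWs.differentiableAt (by simp)) u v w)
      (hasDerivAt_const 0 (0 : ℂ)) (eventually_line (p := fun y => pencil ζ W y v w = 0) ?_ u)
    have hne := (h.contDiffAt_herm (hVU hx) (e 0) (e 0)).continuousAt.eventually_ne
      (by rw [hG]; exact one_ne_zero)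
    filter_upwards [hne, hV.mem_nhds hx] with y hy hyV
    have := hS v w y hyV
    simp only [pencil, hWd]
    field_simp
    linear_combination this
  obtain ⟨-, -, h1, h2, h3⟩ := h.sff_of_pencil (hVU hx) F hm (W' := fderiv ℝ W x)
    (fun u => hT u _ _) (fun u => hT u _ _) (fun u => hT u _ _)
  refine h3 ?_ u v w
  -- As e₂ has the same eigenvalue, its diagonal condition yields a second value of dW(e₂), with
  -- h₂₂₂ = -2h₀₀₂ in place of h₀₀₂.
  have h4 := pencil_diag F (i := 2) (by rw [hm2]; exact hT (e 2) (e 2) (e 2))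
  rw [h1, ← sff_eq_of_eq23 F, h2, hm2] at h4
  have hw : starRingEnd ℂ (m 0) ≠ 0 := left_ne_zero_of_mul_eq_one (F.conj_mul 0)
  have h5 : sff ζ x (e 0) (e 0) (e 2) = -2 * sff ζ x (e 0) (e 0) (e 2) := by
    exact_mod_cast mul_left_cancel₀ (by simp [hw]) h4
  linarith

/-- The first order conditions at a point where `S - W g` has rank one nearby. -/
theorem pencilDeriv_of_rank_one (hx : x ∈ U) {e : Fin 3 → E} {m : Fin 3 → ℂ}
    (F : IsAngleFrame (ζ x) e m) (hm : m 0 = m 1) (hm2 : m 2 ≠ m 0) {W : E → ℂ}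
    (hWx : W x = starRingEnd ℂ (m 0)) (hW : DifferentiableAt ℝ W x)
    (hT : ∀ a b c d, ∀ᶠ y in nhds x, pencil ζ W y a b * pencil ζ W y c d
      = pencil ζ W y a d * pencil ζ W y c b) (u : E) {i j : Fin 3} (hi : i ≠ 2) (hj : j ≠ 2) :
    pencilDeriv ζ x (starRingEnd ℂ (m 0)) (fderiv ℝ W x u) u (e i) (e j) = 0 := by
  have hd := fun a b => h.hasDerivAt_pencil hx hW u (e a) (e b)
  -- The minor on rows i, 2 and columns j, 2. At x only the (2, 2) entry of the pencil is nonzero,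
  -- so the product rule leaves the derivative of the (i, j) entry times that entry.
  have h1 := eq_of_hasDerivAt ((hd i j).mul (hd 2 2)) ((hd i 2).mul (hd 2 j))
    (eventually_line (hT (e i) (e j) (e 2) (e 2)) u)
  have hv : ∀ a b, pencil ζ W x (e a) (e b) = (starRingEnd ℂ (m 2) - starRingEnd ℂ (m 0))
      * (if a = 2 then 1 else 0) * (if b = 2 then 1 else 0) := fun a b => by
    rw [pencil, hWx, F.pencil_eq hm, F.orth, F.orth]
  simp only [zero_smul, add_zero, hv, if_neg hi, if_neg hj, hWx] at h1
  have hne : starRingEnd ℂ (m 2) - starRingEnd ℂ (m 0) ≠ 0 := fun h0 =>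
    hm2 ((starRingEnd ℂ).injective (sub_eq_zero.1 h0))
  simpa [hne] using h1

/-- The case in which the two angles differ at `x`. -/
theorem sff_eq_zero_of_ne {D : Set E} (hD : U ⊆ closure D)
    (hF : ∀ y ∈ D ∩ U, ∃ e m, IsAngleFrame (ζ y) e m ∧ m 0 = m 1)
    (hx : x ∈ U) (hxD : x ∈ D) {e : Fin 3 → E} {m : Fin 3 → ℂ} (F : IsAngleFrame (ζ x) e m)
    (hm : m 0 = m 1) (hm2 : m 2 ≠ m 0) (u v w : E) : sff ζ x u v w = 0 := by
  -- With e₀ and e₂ frozen at their values at x, N is, at each point of D, a real multiple of the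
  -- difference of the simple and the double eigenvalue. Where N ≠ 0 the two differ, and the phase
  -- of N determines W.
  set N : E → ℂ := fun y => herm (ζ y (e 2)) (ζ y (e 2)) * bil (ζ y (e 0)) (ζ y (e 0))
    - herm (ζ y (e 0)) (ζ y (e 0)) * bil (ζ y (e 2)) (ζ y (e 2)) with hN
  have hNs : ∀ y ∈ U, ContDiffAt ℝ ∞ N y := fun y hy =>
    ((h.contDiffAt_herm hy _ _).mul (h.contDiffAt_bil hy _ _)).sub
      ((h.contDiffAt_herm hy _ _).mul (h.contDiffAt_bil hy _ _))
  set V : Set E := U ∩ {y | N y ≠ 0} with hVd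
  have hV : IsOpen V :=
    ContinuousOn.isOpen_inter_preimage (fun y hy => (hNs y hy).continuousAt.continuousWithinAt)
      h.isOpen isOpen_ne
  have hVU : V ⊆ U := Set.inter_subset_left
  have hVD : V ⊆ closure D := hVU.trans hD
  have hxV : x ∈ V := by
    refine ⟨hx, fun h0 => hm2 ?_⟩
    simp only [hN, F.bil_eq, F.orth, if_true, mul_one, one_mul] at h0
    exact ((starRingEnd ℂ).injective (sub_eq_zero.1 h0)).symm
  -- Since the conjugate of m₂ is m₀², N is a real multiple of λ = m₀² - m̄₀, and λ̄ = -m̄₀λ. Hence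
  -- -N̄/N is the double eigenvalue m̄₀, expressed as a smooth function.
  set W : E → ℂ := fun y => -starRingEnd ℂ (N y) * (N y)⁻¹ with hWd
  have hWs : ∀ y ∈ V, ContDiffAt ℝ ∞ W y := fun y hy =>
    (contDiffAt_conj (hNs y (hVU hy))).neg.mul ((hNs y (hVU hy)).inv hy.2)
  have hWD : ∀ y ∈ D ∩ V, ∀ {e' : Fin 3 → E} {m' : Fin 3 → ℂ}, IsAngleFrame (ζ y) e' m' →
      m' 0 = m' 1 → W y = starRingEnd ℂ (m' 0) ∧ m' 2 ≠ m' 0 := by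
    intro y hy e' m' F' hm'
    have p0 := F'.pencil_eq hm' (e 0) (e 0)
    have p2 := F'.pencil_eq hm' (e 2) (e 2)
    have hp := h.prod_eq_one (hVU hy.2) F'
    have hc := F'.conj_mul 0
    have hc2 := F'.conj_mul 2
    have hne : N y ≠ 0 := hy.2.2
    have g0 := h.conj_herm_self (hVU hy.2) (e 0) (e 0)
    have g2 := h.conj_herm_self (hVU hy.2) (e 2) (e 2)
    have n0 := h.conj_herm_self (hVU hy.2) (e 0) (e' 2)
    have n2 := h.conj_herm_self (hVU hy.2) (e 2) (e' 2)
    have hNy : N y = (starRingEnd ℂ (m' 2) - starRingEnd ℂ (m' 0))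
        * (herm (ζ y (e 2)) (ζ y (e 2)) * herm (ζ y (e 0)) (ζ y (e' 2)) ^ 2
          - herm (ζ y (e 0)) (ζ y (e 0)) * herm (ζ y (e 2)) (ζ y (e' 2)) ^ 2) := by
      simp only [hN]
      linear_combination herm (ζ y (e 2)) (ζ y (e 2)) * p0 - herm (ζ y (e 0)) (ζ y (e 0)) * p2
    have hNc := congrArg (starRingEnd ℂ) hNy
    simp only [map_mul, map_sub, map_pow, g0, g2, n0, n2, Complex.conj_conj] at hNc
    refine ⟨?_, fun h0 => hne (by rw [hNy, h0]; ring)⟩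
    simp only [hWd]
    rw [← div_eq_mul_inv, div_eq_iff hne, hNc, hNy, ← sub_eq_zero]
    have hm2' : m' 2 = starRingEnd ℂ (m' 0) ^ 2 := by
      rw [← hm'] at hp
      linear_combination starRingEnd ℂ (m' 0) ^ 2 * hp
        - (starRingEnd ℂ (m' 0) * m' 0 + 1) * m' 2 * hc
    rw [hm2', map_pow, Complex.conj_conj]
    linear_combination (-m' 0) * (herm (ζ y (e 2)) (ζ y (e 2)) * herm (ζ y (e 0)) (ζ y (e' 2)) ^ 2
          - herm (ζ y (e 0)) (ζ y (e 0)) * herm (ζ y (e 2)) (ζ y (e' 2)) ^ 2) * hc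
  have hTD : ∀ y ∈ D ∩ V, ∃ e' m', IsAngleFrame (ζ y) e' m' ∧ m' 0 = m' 1 ∧ m' 2 ≠ m' 0 ∧
      W y = starRingEnd ℂ (m' 0) ∧ ∀ a b, pencil ζ W y a b
        = (starRingEnd ℂ (m' 2) - starRingEnd ℂ (m' 0)) * herm (ζ y a) (ζ y (e' 2))
          * herm (ζ y b) (ζ y (e' 2)) := by
    intro y hy
    obtain ⟨e', m', F', hm'⟩ := hF y ⟨hy.1, hVU hy.2⟩
    obtain ⟨hWy, hne⟩ := hWD y hy F' hm'
    exact ⟨e', m', F', hm', hne, hWy, fun a b => by rw [pencil, hWy, F'.pencil_eq hm']⟩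
  have hpc : ∀ a b, ContinuousOn (fun y => pencil ζ W y a b) V := fun a b y hy =>
    (h.continuousAt_pencil (hVU hy) (hWs y hy) a b).continuousWithinAt
  -- Rank at most one, phrased as the vanishing of 2 × 2 minors: no frame appears, and the condition
  -- passes from D to all of V.
  have hT : ∀ a b c d, ∀ y ∈ V, pencil ζ W y a b * pencil ζ W y c d
      = pencil ζ W y a d * pencil ζ W y c b := by
    intro a b c d
    refine eqOn_of_dense hV hVD ((hpc _ _).mul (hpc _ _)) ((hpc _ _).mul (hpc _ _)) ?_
    intro y hy
    obtain ⟨e', m', -, -, -, -, hp⟩ := hTD y hy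
    simp only [hp]; ring
  have hT' : ∀ y ∈ V, ∀ a b c d, ∀ᶠ z in nhds y, pencil ζ W z a b * pencil ζ W z c d
      = pencil ζ W z a d * pencil ζ W z c b := fun y hy a b c d =>
    Filter.eventually_of_mem (hV.mem_nhds hy) (hT a b c d)
  have hWdiff : ∀ y ∈ V, DifferentiableAt ℝ W y := fun y hy =>
    (hWs y hy).differentiableAt (by simp)
  have hdWs : ∀ y ∈ V, ContDiffAt ℝ ∞ (fderiv ℝ W) y := fun y hy =>
    (hWs y hy).fderiv_right (m := ∞) (by simp)
  have hdW : ∀ a, ∀ y ∈ V, ContinuousAt (fun z => fderiv ℝ W z a) y := fun a y hy =>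
    (hdWs y hy).continuousAt.clm_apply continuousAt_const
  -- Where the pencil has rank one, this says that dW is proportional to the covector spanning its
  -- image. It is a frame-free closed condition, checked on D and then available for
  -- differentiation.
  have hprop : ∀ a b c, ∀ y ∈ V, fderiv ℝ W y a * pencil ζ W y b c
      = fderiv ℝ W y b * pencil ζ W y a c := by
    intro a b c
    refine eqOn_of_dense hV hVD
      (ContinuousOn.mul (fun y hy => (hdW _ y hy).continuousWithinAt) (hpc _ _))
      (ContinuousOn.mul (fun y hy => (hdW _ y hy).continuousWithinAt) (hpc _ _)) ?_
    intro y hy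
    obtain ⟨e', m', F', hm', hne, hWy, hp⟩ := hTD y hy
    have hd := fun u {i j : Fin 3} (hi : i ≠ 2) (hj : j ≠ 2) =>
      h.pencilDeriv_of_rank_one (hVU hy.2) F' hm' hne hWy (hWdiff y hy.2) (hT' y hy.2) u hi hj
    obtain ⟨d0, d1, -⟩ := h.sff_of_pencil (hVU hy.2) F' hm' (W' := fderiv ℝ W y)
      (fun u => hd u (by decide) (by decide)) (fun u => hd u (by decide) (by decide))
      (fun u => hd u (by decide) (by decide))
    have hlin : ∀ a, fderiv ℝ W y a = herm (ζ y a) (ζ y (e' 2)) * fderiv ℝ W y (e' 2) := by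
      intro a
      obtain ⟨n, hn, hn2⟩ := F'.eq_sum a
      rw [hn2]
      conv_lhs => rw [hn]
      simp [d0, d1]
    rw [hp, hp, hlin a, hlin b]; ring
  obtain ⟨hWx, -⟩ := hWD x ⟨hxD, hxV⟩ F hm
  have hd := fun u {i j : Fin 3} (hi : i ≠ 2) (hj : j ≠ 2) =>
    h.pencilDeriv_of_rank_one hx F hm hm2 hWx (hWdiff x hxV) (hT' x hxV) u hi hj
  obtain ⟨d0, d1, d2, -, hfin⟩ := h.sff_of_pencil hx F hm (W' := fderiv ℝ W x)
    (fun u => hd u (by decide) (by decide)) (fun u => hd u (by decide) (by decide))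
    (fun u => hd u (by decide) (by decide))
  refine hfin ?_ u v w
  have hsecond : ∀ z a, HasDerivAt (fun s : ℝ => fderiv ℝ W (x + s • z) a)
      (fderiv ℝ (fderiv ℝ W) x z a) 0 := fun z a =>
    ((ContinuousLinearMap.apply ℝ ℂ a).hasFDerivAt).comp_hasDerivAt (0 : ℝ)
      (hasDerivAt_line ((hdWs x hxV).differentiableAt (by simp)) z)
  have hsymm : IsSymmSndFDerivAt ℝ W x := (hWs x hxV).isSymmSndFDerivAt (by
    rw [minSmoothness_of_isRCLikeNormedField]
    exact WithTop.coe_le_coe.2 (OrderTop.le_top (2 : ℕ∞)))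
  have hpen := fun z a b => h.hasDerivAt_pencil hx (hWdiff x hxV) z (e a) (e b)
  have hv : ∀ a b, pencil ζ W x (e a) (e b) = (starRingEnd ℂ (m 2) - starRingEnd ℂ (m 0))
      * (if a = 2 then 1 else 0) * (if b = 2 then 1 else 0) := fun a b => by
    rw [pencil, hWx, F.pencil_eq hm, F.orth, F.orth]
  -- Differentiating `hprop` at x: dW(eᵢ) and the (i, 2) entry of the pencil vanish there, so only
  -- one term survives on each side.
  have hder : ∀ i z, i ≠ 2 → fderiv ℝ W x (e i) = 0 →
      fderiv ℝ (fderiv ℝ W) x z (e i) * (starRingEnd ℂ (m 2) - starRingEnd ℂ (m 0))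
      = fderiv ℝ W x (e 2)
        * pencilDeriv ζ x (starRingEnd ℂ (m 0)) (fderiv ℝ W x z) z (e i) (e 2) := by
    intro i z hi hi0
    have h1 := eq_of_hasDerivAt ((hsecond z (e i)).mul (hpen z 2 2))
      ((hsecond z (e 2)).mul (hpen z i 2))
      (eventually_line (Filter.eventually_of_mem (hV.mem_nhds hxV) (hprop (e i) (e 2) (e 2))) z)
    simpa [hv, hi, hi0, hWx] using h1
  have e0 := hder 0 (e 1) (by decide) d0
  have e1 := hder 1 (e 0) (by decide) d1
  have hcomm := h.pencil_commutator hx F hm (W' := fderiv ℝ W x)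
  -- Symmetry of the second derivative of W in e₀, e₁ makes dW(e₂) times the commutator vanish; the
  -- commutator itself is nonzero.
  have hprod : fderiv ℝ W x (e 2) * (((1 / √3 : ℝ) : ℂ) * tri (ζ x (e 0)) (ζ x (e 1)) (ζ x (e 2))
      * (starRingEnd ℂ (m 0) - starRingEnd ℂ (m 2))) = 0 := by
    rw [← hcomm, mul_sub, ← e0, ← e1, hsymm (e 1) (e 0), sub_self]
  have hr : ((1 / √3 : ℝ) : ℂ) ≠ 0 := Complex.ofReal_ne_zero.2 (by positivity)
  have hne : starRingEnd ℂ (m 0) - starRingEnd ℂ (m 2) ≠ 0 := fun h0 =>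
    hm2 ((starRingEnd ℂ).injective (sub_eq_zero.1 h0)).symm
  have hz := (mul_eq_zero.1 hprod).resolve_right (mul_ne_zero (mul_ne_zero hr F.tri_ne_zero) hne)
  rw [hz] at d2
  have hw : starRingEnd ℂ (m 0) ≠ 0 := left_ne_zero_of_mul_eq_one (F.conj_mul 0)
  simpa [hw] using d2.symm

/-- A Lagrangian form for which two of the angles agree on a dense set is totally geodesic. -/
theorem sff_eq_zero {D : Set E} (hD : U ⊆ closure D)
    (hF : ∀ y ∈ D ∩ U, ∃ e m, IsAngleFrame (ζ y) e m ∧ m 0 = m 1) (hx : x ∈ U) (u v w : E) :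
    sff ζ x u v w = 0 := by
  by_contra hne
  set V : Set E := U ∩ {y | sff ζ y u v w ≠ 0} with hVd
  have hV : IsOpen V := (h.continuousOn_sff u v w).isOpen_inter_preimage h.isOpen isOpen_ne
  have hVU : V ⊆ U := Set.inter_subset_left
  -- On V the form h is nonzero, so the case of distinct eigenvalues is excluded and all three agree
  -- at every point of D ∩ V.
  have key : ∀ y ∈ D ∩ V, ∀ e m, IsAngleFrame (ζ y) e m → m 0 = m 1 → m 2 = m 0 := by
    intro y hy e m F hm
    by_contra hm2
    exact hy.2.2 (h.sff_eq_zero_of_ne hD hF (hVU hy.2) hy.1 F hm hm2 u v w)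
  obtain ⟨y, hyV, hyD⟩ := mem_closure_iff.1 (hD hx) V hV ⟨hx, hne⟩
  obtain ⟨e, m, F, hm⟩ := hF y ⟨hyD, hVU hyV⟩
  refine hyV.2 (h.sff_eq_zero_of_scalar hV hVU (hVU.trans hD) (fun z hz => ?_) hyV F hm
    (key y ⟨hyD, hyV⟩ e m F hm) u v w)
  obtain ⟨e', m', F', hm'⟩ := hF z ⟨hz.1, hVU hz.2⟩
  refine ⟨starRingEnd ℂ (m' 0), fun a b => ?_⟩
  have := F'.pencil_eq hm' a b
  rw [key z hz e' m' F' hm', sub_self, zero_mul, zero_mul] at this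
  exact sub_eq_zero.1 this

end IsLagrangianForm

end Forms

/-! ### The left-invariant frame of S³ × S³. -/

/-- The identification of `Im ℍ × Im ℍ` with `ℂ³`. -/
def toC3 : HxH →ₗ[ℝ] C3 where
  toFun Z := ![⟨1 / √3 * (Z.1.imI + Z.2.imI), Z.1.imI - Z.2.imI⟩,
    ⟨1 / √3 * (Z.1.imJ + Z.2.imJ), Z.1.imJ - Z.2.imJ⟩,
    ⟨1 / √3 * (Z.1.imK + Z.2.imK), Z.1.imK - Z.2.imK⟩]
  map_add' Z Z' := by
    ext k; fin_cases k <;> apply Complex.ext <;> simp <;> ring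
  map_smul' c Z := by
    ext k; fin_cases k <;> apply Complex.ext <;> simp <;> ring

/-- The vector `Z` at `y`, in the left-invariant frame. -/
def leftC : HxH →L[ℝ] HxH →L[ℝ] C3 :=
  LinearMap.toContinuousLinearMap (LinearMap.toContinuousLinearMap.toLinearMap ∘ₗ
    LinearMap.mk₂ ℝ (fun y Z : HxH => toC3 (star y.1 * Z.1, star y.2 * Z.2))
      (fun y y' Z => by rw [← map_add]; simp [add_mul])
      (fun c y Z => by rw [← map_smul]; simp)
      (fun y Z Z' => by rw [← map_add]; simp [mul_add])
      (fun c y Z => by rw [← map_smul]; simp))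

theorem leftC_apply (y Z : HxH) : leftC y Z = toC3 (star y.1 * Z.1, star y.2 * Z.2) := rfl

theorem IsTangent.exists_eq {x : S3xS3} {Z : HxH} (hZ : IsTangent x Z) :
    ∃ a b : Quaternion ℝ, a.re = 0 ∧ b.re = 0 ∧
      Z = ((x.1 : Quaternion ℝ) * a, (x.2 : Quaternion ℝ) * b) := by
  have hrep : ∀ (p : S3) (a : Quaternion ℝ), inner ℝ (p : Quaternion ℝ) a = (0 : ℝ) →
      ∃ b : Quaternion ℝ, b.re = 0 ∧ a = (p : Quaternion ℝ) * b := by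
    intro p a h
    have ha : a = (p : Quaternion ℝ) * (star (p : Quaternion ℝ) * a) := by
      rw [← coe_inv, mul_inv_cancel_left₀ (ne_zero_of_mem_unit_sphere p)]
    refine ⟨star (p : Quaternion ℝ) * a, ?_, ha⟩
    refine Eq.trans ?_ h
    simp only [inner_eq_coord, Quaternion.re_mul, Quaternion.re_star, Quaternion.imI_star,
      Quaternion.imJ_star, Quaternion.imK_star]
    ring
  obtain ⟨a, ha, ha'⟩ := hrep x.1 _ hZ.1
  obtain ⟨b, hb, hb'⟩ := hrep x.2 _ hZ.2
  exact ⟨a, b, ha, hb, Prod.ext ha' hb'⟩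

theorem star_mul_coe_mul (p : S3) (a : Quaternion ℝ) :
    star (p : Quaternion ℝ) * ((p : Quaternion ℝ) * a) = a := by
  rw [← mul_assoc, star_mul_coe, one_mul]

theorem leftC_incl (x : S3xS3) (a b : Quaternion ℝ) :
    leftC (incl x) ((x.1 : Quaternion ℝ) * a, (x.2 : Quaternion ℝ) * b) = toC3 (a, b) := by
  rw [leftC_apply, incl]; simp only [star_mul_coe_mul]

theorem inv_sqrt_three_sq : (1 / √3 : ℝ) ^ 2 = 1 / 3 := by
  rw [div_pow, Real.sq_sqrt (by norm_num)]; norm_num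

theorem g_eq_herm {x : S3xS3} {Z Z' : HxH} (hZ : IsTangent x Z) (hZ' : IsTangent x Z') :
    g x Z Z' = (herm (leftC (incl x) Z) (leftC (incl x) Z')).re := by
  obtain ⟨a, b, ha, hb, rfl⟩ := hZ.exists_eq
  obtain ⟨c, d, hc, hd, rfl⟩ := hZ'.exists_eq
  have hs := inv_sqrt_three_sq
  rw [leftC_incl, leftC_incl, g_eq]
  simp only [eucl, star_mul_coe_mul, inner_mul_mul, inner_coe_self, one_mul]
  generalize hr : (1 / √3 : ℝ) = r at hs
  simp [inner_eq_coord, ha, hb, hc, hd, toC3, herm, bil, conj3]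
  simp only [one_div] at hr
  rw [hr]
  linear_combination (-((a.imI + b.imI) * (c.imI + d.imI) + (a.imJ + b.imJ) * (c.imJ + d.imJ)
    + (a.imK + b.imK) * (c.imK + d.imK))) * hs

theorem inner_coe_mul (p : S3) (b : Quaternion ℝ) :
    (inner ℝ (p : Quaternion ℝ) ((p : Quaternion ℝ) * b) : ℝ) = b.re := by
  have h := inner_mul_mul (p : Quaternion ℝ) 1 b
  rw [mul_one, inner_coe_self, one_mul] at h
  rw [h]
  simp only [inner_eq_coord, Quaternion.re_one, Quaternion.imI_one, Quaternion.imJ_one,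
    Quaternion.imK_one]
  ring

theorem J_left_mul (x : S3xS3) (a b : Quaternion ℝ) :
    J x ((x.1 : Quaternion ℝ) * a, (x.2 : Quaternion ℝ) * b)
      = ((x.1 : Quaternion ℝ) * ((1 / √3 : ℝ) • ((2 : ℝ) • b - a)),
        (x.2 : Quaternion ℝ) * ((1 / √3 : ℝ) • ((-2 : ℝ) • a + b))) := by
  simp only [J, LinearMap.coe_mk, AddHom.coe_mk, coe_inv, mul_assoc, star_mul_coe_mul]
  ext1 <;> simp only [mul_smul_comm, mul_sub, mul_add, Prod.smul_mk]

theorem IsTangent.map_J {x : S3xS3} {Z : HxH} (hZ : IsTangent x Z) : IsTangent x (J x Z) := by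
  obtain ⟨a, b, ha, hb, rfl⟩ := hZ.exists_eq
  rw [J_left_mul]
  exact ⟨by rw [inner_coe_mul]; simp [ha, hb], by rw [inner_coe_mul]; simp [ha, hb]⟩

/-- For imaginary a, b the coordinate in ℂ³ is (a + b)/√3 + i(a - b). `J` exchanges sum and
difference up to the factors √3 and -1/√3, which the scaling of the real part absorbs. -/
theorem leftC_J {x : S3xS3} {Z : HxH} (hZ : IsTangent x Z) :
    leftC (incl x) (J x Z) = Complex.I • leftC (incl x) Z := by
  obtain ⟨a, b, ha, hb, rfl⟩ := hZ.exists_eq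
  have hs := inv_sqrt_three_sq
  rw [J_left_mul, leftC_incl, leftC_incl]
  generalize hr : (1 / √3 : ℝ) = r at hs
  ext k
  fin_cases k <;> apply Complex.ext <;> simp [toC3] <;> simp only [← one_div, hr]
  · linear_combination 3 * (b.imI - a.imI) * hs
  · ring
  · linear_combination 3 * (b.imJ - a.imJ) * hs
  · ring
  · linear_combination 3 * (b.imK - a.imK) * hs
  · ring

/-- `P` exchanges the two imaginary quaternions, fixing their sum and negating their difference. -/
theorem leftC_P {x : S3xS3} {Z : HxH} (hZ : IsTangent x Z) :
    leftC (incl x) (P x Z) = conj3 (leftC (incl x) Z) := by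
  obtain ⟨a, b, ha, hb, rfl⟩ := hZ.exists_eq
  have hP : P x ((x.1 : Quaternion ℝ) * a, (x.2 : Quaternion ℝ) * b)
      = ((x.1 : Quaternion ℝ) * b, (x.2 : Quaternion ℝ) * a) := by
    simp only [P, LinearMap.coe_mk, AddHom.coe_mk, coe_inv, mul_assoc, star_mul_coe_mul]
  rw [hP, leftC_incl, leftC_incl]
  ext k
  fin_cases k <;> apply Complex.ext <;> simp [toC3, conj3, add_comm]

theorem eq_of_leftC_eq {x : S3xS3} {Z Z' : HxH} (hZ : IsTangent x Z) (hZ' : IsTangent x Z')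
    (h : leftC (incl x) Z = leftC (incl x) Z') : Z = Z' := by
  have ht : IsTangent x (Z - Z') := by
    refine ⟨?_, ?_⟩
    · rw [Prod.fst_sub, inner_sub_right, hZ.1, hZ'.1, sub_zero]
    · rw [Prod.snd_sub, inner_sub_right, hZ.2, hZ'.2, sub_zero]
  by_contra hne
  have h1 := g_pos x (sub_ne_zero.2 hne)
  rw [g_eq_herm ht ht, map_sub, h, sub_self] at h1
  simp [herm, bil] at h1

/-- `leftC` is bilinear in base point and vector, so `leftC Z Z'` is the derivative of the
trivialisation itself. The identity shows that in the frame the Levi-Civita connection is the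
componentwise derivative plus `gam`. -/
theorem leftC_connection {x : S3xS3} {Z Z' : HxH} (hZ : IsTangent x Z) (hZ' : IsTangent x Z') :
    leftC Z Z' + gam (leftC (incl x) Z) (leftC (incl x) Z')
      = leftC (incl x) (((inner ℝ Z.1 Z'.1 : ℝ) • (x.1 : Quaternion ℝ),
        (inner ℝ Z.2 Z'.2 : ℝ) • (x.2 : Quaternion ℝ)) + diffTensor x Z Z') := by
  obtain ⟨a, b, ha, hb, rfl⟩ := hZ.exists_eq
  obtain ⟨c, d, hc, hd, rfl⟩ := hZ'.exists_eq
  have hcan2 : ∀ (p : S3) (a b : Quaternion ℝ),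
      star ((p : Quaternion ℝ) * a) * ((p : Quaternion ℝ) * b) = star a * b := by
    intro p a b
    rw [star_mul, mul_assoc, star_mul_coe_mul]
  rw [leftC_incl, leftC_incl, map_add, leftC_apply, leftC_apply, leftC_apply]
  simp only [diffTensor, incl, hcan2, coe_inv, star_mul_coe_mul, mul_neg, mul_smul_comm, star_mul_coe]
  have hs := inv_sqrt_three_sq
  have hr2 : (1 / (2 * √3) : ℝ) = (1 / √3) / 2 := by field_simp
  have h1 : (1 : Quaternion ℝ).imI = 0 := rfl
  have h2 : (1 : Quaternion ℝ).imJ = 0 := rfl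
  have h3 : (1 : Quaternion ℝ).imK = 0 := rfl
  rw [gam, hr2]
  ext k
  fin_cases k <;> apply Complex.ext <;>
    simp [toC3, crs, conj3, cross, ha, hb, hc, hd, h1, h2, h3, -Complex.ofReal_div, -Complex.ofReal_inv,
      -one_div] <;> generalize (1 / √3 : ℝ) = r at hs ⊢
  · linear_combination (3 / 2 * r * ((a.imJ + b.imJ) * (c.imK + d.imK) - (a.imK + b.imK) * (c.imJ + d.imJ))) * hs
  · linear_combination (1 / 2 * (5 * ((a.imJ + b.imJ) * (c.imK - d.imK) - (a.imK + b.imK) * (c.imJ - d.imJ))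
      + ((a.imJ - b.imJ) * (c.imK + d.imK) - (a.imK - b.imK) * (c.imJ + d.imJ)))) * hs
  · linear_combination (3 / 2 * r * ((a.imK + b.imK) * (c.imI + d.imI) - (a.imI + b.imI) * (c.imK + d.imK))) * hs
  · linear_combination (1 / 2 * (5 * ((a.imK + b.imK) * (c.imI - d.imI) - (a.imI + b.imI) * (c.imK - d.imK))
      + ((a.imK - b.imK) * (c.imI + d.imI) - (a.imI - b.imI) * (c.imK + d.imK)))) * hs
  · linear_combination (3 / 2 * r * ((a.imI + b.imI) * (c.imJ + d.imJ) - (a.imJ + b.imJ) * (c.imI + d.imI))) * hs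
  · linear_combination (1 / 2 * (5 * ((a.imI + b.imI) * (c.imJ - d.imJ) - (a.imJ + b.imJ) * (c.imI - d.imI))
      + ((a.imI - b.imI) * (c.imJ + d.imJ) - (a.imJ - b.imJ) * (c.imI + d.imI)))) * hs

theorem herm_self_eq_zero {z : C3} (h : (herm z z).re = 0) : z = 0 := by
  have h1 : Complex.normSq (z 0) + Complex.normSq (z 1) + Complex.normSq (z 2) = 0 := by
    rw [← h]
    simp [herm, bil, conj3, Complex.normSq_apply]
  have h2 := fun k => Complex.normSq_nonneg (z k)
  have hz : ∀ k, Complex.normSq (z k) = 0 := by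
    intro k
    have := h2 0; have := h2 1; have := h2 2
    fin_cases k <;> simp <;> rw [← Complex.normSq_eq_zero] <;> linarith
  exact funext fun k => Complex.normSq_eq_zero.1 (hz k)

/-- A vector `z` with `J`-orthogonality to a Lagrangian subspace of `ℂ³` lies in the subspace. -/
theorem exists_eq_of_isotropic {E : Type*} [NormedAddCommGroup E] [NormedSpace ℝ E]
    [FiniteDimensional ℝ E] (hE : Module.finrank ℝ E = 3) {L : E →L[ℝ] C3}
    (hL : Function.Injective L) (hiso : ∀ v w, (herm (L v) (L w)).im = 0) {z : C3}
    (hz : ∀ w, (herm z (L w)).im = 0) : ∃ v, L v = z := by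
  set Φ : E × E →ₗ[ℝ] C3 := (L : E →ₗ[ℝ] C3).coprod
    ((Complex.I • LinearMap.id : C3 →ₗ[ℝ] C3) ∘ₗ (L : E →ₗ[ℝ] C3)) with hΦ
  have hΦa : ∀ v w, Φ (v, w) = L v + Complex.I • L w := fun v w => rfl
  have hinj : Function.Injective Φ := by
    rw [injective_iff_map_eq_zero]
    rintro ⟨v, w⟩ h0
    rw [hΦa] at h0
    -- By isotropy the summand i·L w contributes nothing to the real part of the product with L v,
    -- so |L v|² = 0.
    have h1 : (herm (L v + Complex.I • L w) (L v)).re = 0 := by rw [h0]; simp [herm, bil]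
    rw [herm_add_left, herm_smul_left] at h1
    simp [hiso] at h1
    have hv : v = 0 := hL (by rw [herm_self_eq_zero h1, map_zero])
    rw [hv, map_zero, zero_add] at h0
    have hw : w = 0 := hL (by rw [map_zero]; exact (smul_eq_zero.1 h0).resolve_left Complex.I_ne_zero)
    rw [hv, hw]; rfl
  have hsurj : Function.Surjective Φ := by
    refine (LinearMap.injective_iff_surjective_of_finrank_eq_finrank ?_).1 hinj
    rw [Module.finrank_prod, hE, Module.finrank_pi_fintype]
    simp
  obtain ⟨⟨v, w⟩, rfl⟩ := hsurj z
  -- For z = L v + i·L w this imaginary part is |L w|², so z = L v.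
  have h1 := hz w
  rw [hΦa, herm_add_left, herm_smul_left] at h1
  simp [hiso] at h1
  exact ⟨v, by rw [hΦa, herm_self_eq_zero h1]; simp⟩

/-! ### The immersion in a chart as a Lagrangian one-form. -/

section Chart

variable {M : Type*} [TopologicalSpace M] [ChartedSpace (EuclideanSpace ℝ (Fin 3)) M]
  [IsManifold (𝓡 3) ∞ M] {f : M → S3xS3}

local notation "E3" => EuclideanSpace ℝ (Fin 3)

omit [IsManifold (𝓡 3) ∞ M] in
theorem IsLagrangianImmersion.contMDiff_incl (hf : IsLagrangianImmersion f) :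
    ContMDiff (𝓡 3) 𝓘(ℝ, HxH) ∞ (fun y => incl (f y)) :=
  NearlyKahler.contMDiff_incl.comp hf.smooth

omit [IsManifold (𝓡 3) ∞ M] in
theorem IsLagrangianImmersion.mdiff (hf : IsLagrangianImmersion f) (x : M) :
    MDifferentiableAt (𝓡 3) 𝓘(ℝ, HxH) (fun y => incl (f y)) x :=
  (hf.contMDiff_incl x).mdifferentiableAt (by simp)

omit [IsManifold (𝓡 3) ∞ M] in
theorem mvfderiv_coe_sphere_comp {u : M → S3} {x : M}
    (hu : MDifferentiableAt (𝓡 3) (𝓡 3) u x) (v : TangentSpace (𝓡 3) x)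
    (h0 : mvfderiv (𝓡 3) (fun y => (u y : Quaternion ℝ)) x v = 0) :
    mfderiv (𝓡 3) (𝓡 3) u x v = 0 := by
  have h1 : mvfderiv (𝓡 3) (fun y => (u y : Quaternion ℝ)) x v
      = mvfderiv (𝓡 3) ((↑) : S3 → Quaternion ℝ) (u x) (mfderiv (𝓡 3) (𝓡 3) u x v) :=
    congrArg (fun L => L v) (mfderiv_comp x (g := ((↑) : S3 → Quaternion ℝ))
      ((contMDiff_coe_sphere (u x)).mdifferentiableAt one_ne_zero) hu)
  rw [h1] at h0
  exact injective_mvfderiv_subtypeVal_sphere (u x) (by rw [h0, map_zero])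

omit [IsManifold (𝓡 3) ∞ M] in
theorem IsLagrangianImmersion.pushforward_injective (hf : IsLagrangianImmersion f) (x : M) :
    Function.Injective (pushforward (𝓡 3) f x) := by
  rw [injective_iff_map_eq_zero]
  intro v hv
  have hd : MDifferentiableAt (𝓡 3) ((𝓡 3).prod (𝓡 3)) f x :=
    (hf.smooth x).mdifferentiableAt (by simp)
  have e1 := mvfderiv_comp_apply (hf.mdiff x) (hasFDerivAt_fst (𝕜 := ℝ)) v
  have e2 := mvfderiv_comp_apply (hf.mdiff x) (hasFDerivAt_snd (𝕜 := ℝ)) v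
  rw [show mvfderiv (𝓡 3) (fun y => incl (f y)) x v = 0 from hv, map_zero] at e1 e2
  have d1 := mvfderiv_coe_sphere_comp (u := fun y => (f y).1) hd.fst v e1
  have d2 := mvfderiv_coe_sphere_comp (u := fun y => (f y).2) hd.snd v e2
  have h1 : mfderiv (𝓡 3) ((𝓡 3).prod (𝓡 3)) f x v = 0 := by
    have := mfderiv_prodMk hd.fst hd.snd
    have h2 := congrArg (fun L => L v) this
    refine h2.trans ?_
    exact Prod.ext d1 d2
  exact hf.immersion x (by rw [h1, map_zero])

/-- The immersion in the chart at `x₀`. -/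
def chartMap (f : M → S3xS3) (x₀ : M) (y : E3) : HxH :=
  incl (f ((extChartAt (𝓡 3) x₀).symm y))

/-- The representation of tangent vectors in the chart at `x₀`. -/
def chartVec (x₀ z : M) : TangentSpace (𝓡 3) z →L[ℝ] E3 :=
  mfderiv (𝓡 3) 𝓘(ℝ, E3) (extChartAt (𝓡 3) x₀) z

/-- The differential of the immersion in the chart at `x₀` and in the left-invariant frame. -/
def chartForm (f : M → S3xS3) (x₀ : M) (y : E3) : E3 →L[ℝ] C3 :=
  (leftC (chartMap f x₀ y)).comp (fderiv ℝ (chartMap f x₀) y)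

namespace IsLagrangianImmersion

variable (hf : IsLagrangianImmersion f) (x₀ : M)
include hf

theorem contDiffOn_chartMap : ContDiffOn ℝ ∞ (chartMap f x₀) (extChartAt (𝓡 3) x₀).target := by
  have := hf.contMDiff_incl.comp_contMDiffOn (contMDiffOn_extChartAt_symm (I := 𝓡 3) (n := ∞) x₀)
  exact contMDiffOn_iff_contDiffOn.1 this

theorem contDiffAt_chartMap {y : E3} (hy : y ∈ (extChartAt (𝓡 3) x₀).target) :
    ContDiffAt ℝ ∞ (chartMap f x₀) y :=
  (hf.contDiffOn_chartMap x₀).contDiffAt ((isOpen_extChartAt_target x₀).mem_nhds hy)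

theorem pushforward_eq {z : M} (hz : z ∈ (extChartAt (𝓡 3) x₀).source)
    (v : TangentSpace (𝓡 3) z) : pushforward (𝓡 3) f z v
      = fderiv ℝ (chartMap f x₀) (extChartAt (𝓡 3) x₀ z)
        (chartVec x₀ z v) := by
  have : IsManifold (𝓡 3) 1 M := IsManifold.of_le (n := ∞) (by simp)
  have hu : MDifferentiableAt (𝓡 3) 𝓘(ℝ, E3) (extChartAt (𝓡 3) x₀) z :=
    mdifferentiableAt_extChartAt (by rwa [extChartAt_source] at hz)
  have h1 := mvfderiv_comp_apply hu (((hf.contDiffAt_chartMap x₀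
    ((extChartAt (𝓡 3) x₀).map_source hz)).differentiableAt (by simp)).hasFDerivAt) v
  have h2 : (fun y => incl (f y)) =ᶠ[nhds z]
      fun y => chartMap f x₀ (extChartAt (𝓡 3) x₀ y) := by
    filter_upwards [(isOpen_extChartAt_source x₀).mem_nhds hz] with y hy
    rw [chartMap, (extChartAt (𝓡 3) x₀).left_inv hy]
  have h3 : mvfderiv (𝓡 3) (fun y => incl (f y)) z
      = mvfderiv (𝓡 3) (fun y => chartMap f x₀ (extChartAt (𝓡 3) x₀ y)) z := h2.mfderiv_eq
  rw [pushforward, h3]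
  exact h1

omit hf in
theorem _root_.NearlyKahler.exists_mfderiv_extChartAt {z : M}
    (hz : z ∈ (extChartAt (𝓡 3) x₀).source) (w : E3) :
    ∃ v : TangentSpace (𝓡 3) z, chartVec x₀ z v = w := by
  have : IsManifold (𝓡 3) 1 M := IsManifold.of_le (n := ∞) (by simp)
  exact ⟨_, (isInvertible_mfderiv_extChartAt hz).self_apply_inverse w⟩

/-- Every vector of the chart is the image of a tangent vector. -/
theorem exists_pushforward {y : E3} (hy : y ∈ (extChartAt (𝓡 3) x₀).target) (w : E3) :
    ∃ v : TangentSpace (𝓡 3) ((extChartAt (𝓡 3) x₀).symm y),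
      chartVec x₀ ((extChartAt (𝓡 3) x₀).symm y) v = w ∧
      pushforward (𝓡 3) f ((extChartAt (𝓡 3) x₀).symm y) v
        = fderiv ℝ (chartMap f x₀) y w := by
  have hz := (extChartAt (𝓡 3) x₀).map_target hy
  obtain ⟨v, hv⟩ := exists_mfderiv_extChartAt x₀ hz w
  refine ⟨v, hv, ?_⟩
  rw [hf.pushforward_eq x₀ hz, hv, (extChartAt (𝓡 3) x₀).right_inv hy]

theorem isTangent_fderiv {y : E3} (hy : y ∈ (extChartAt (𝓡 3) x₀).target) (w : E3) :
    IsTangent (f ((extChartAt (𝓡 3) x₀).symm y)) (fderiv ℝ (chartMap f x₀) y w) := by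
  obtain ⟨v, -, hv⟩ := hf.exists_pushforward x₀ hy w
  rw [← hv]
  exact pushforward_isTangent _ (hf.mdiff _) v

theorem fderiv_chartForm_apply {y : E3} (hy : y ∈ (extChartAt (𝓡 3) x₀).target) (u v : E3) :
    fderiv ℝ (chartForm f x₀) y u v
      = leftC (fderiv ℝ (chartMap f x₀) y u) (fderiv ℝ (chartMap f x₀) y v)
        + leftC (chartMap f x₀ y) (fderiv ℝ (fderiv ℝ (chartMap f x₀)) y u v) := by
  have h1 : DifferentiableAt ℝ (chartMap f x₀) y :=
    (hf.contDiffAt_chartMap x₀ hy).differentiableAt (by simp)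
  have h2 : DifferentiableAt ℝ (fderiv ℝ (chartMap f x₀)) y :=
    ((hf.contDiffAt_chartMap x₀ hy).fderiv_right (m := 1)
      (WithTop.coe_le_coe.2 (OrderTop.le_top (2 : ℕ∞)))).differentiableAt one_ne_zero
  have h3 : HasFDerivAt (chartForm f x₀) _ y :=
    (leftC.hasFDerivAt.comp y h1.hasFDerivAt).clm_comp h2.hasFDerivAt
  rw [h3.fderiv]
  simp [add_comm]

/-- The covariant derivative in the chart and in the left-invariant frame. -/
theorem chartForm_connection {y : E3} (hy : y ∈ (extChartAt (𝓡 3) x₀).target) (u v : E3) :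
    fderiv ℝ (chartForm f x₀) y u v + gam (chartForm f x₀ y u) (chartForm f x₀ y v)
      = leftC (chartMap f x₀ y) (fderiv ℝ (fderiv ℝ (chartMap f x₀)) y u v
        + (((inner ℝ (fderiv ℝ (chartMap f x₀) y u).1 (fderiv ℝ (chartMap f x₀) y v).1 : ℝ)
            • ((f ((extChartAt (𝓡 3) x₀).symm y)).1 : Quaternion ℝ),
          (inner ℝ (fderiv ℝ (chartMap f x₀) y u).2 (fderiv ℝ (chartMap f x₀) y v).2 : ℝ)
            • ((f ((extChartAt (𝓡 3) x₀).symm y)).2 : Quaternion ℝ))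
          + diffTensor (f ((extChartAt (𝓡 3) x₀).symm y)) (fderiv ℝ (chartMap f x₀) y u)
            (fderiv ℝ (chartMap f x₀) y v))) := by
  have := leftC_connection (hf.isTangent_fderiv x₀ hy u) (hf.isTangent_fderiv x₀ hy v)
  rw [map_add, chartMap, ← this, hf.fderiv_chartForm_apply x₀ hy]
  simp only [chartForm, chartMap, ContinuousLinearMap.comp_apply]
  abel

/-- Isotropy is the Lagrangian condition, `J` being multiplication by i. Torsion-freeness holds
because the second derivative of the chart map and the zeroth order terms of the connection are both
symmetric. -/
theorem isLagrangianForm :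
    IsLagrangianForm (extChartAt (𝓡 3) x₀).target (chartForm f x₀) where
  isOpen := isOpen_extChartAt_target x₀
  smooth := by
    have h1 := hf.contDiffOn_chartMap x₀
    exact (leftC.contDiff.comp_contDiffOn h1).clm_comp
      (h1.fderiv_of_isOpen (m := ∞) (isOpen_extChartAt_target x₀) (by simp))
  isotropic := by
    intro y hy v w
    obtain ⟨v', -, hv'⟩ := hf.exists_pushforward x₀ hy v
    obtain ⟨w', -, hw'⟩ := hf.exists_pushforward x₀ hy w
    have h1 := hf.lagrangian _ v' w'
    rw [hv', hw'] at h1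
    have ht := hf.isTangent_fderiv x₀ hy v
    rw [g_eq_herm ht.map_J (hf.isTangent_fderiv x₀ hy w), leftC_J ht, herm_smul_left] at h1
    simpa [chartForm, chartMap] using h1
  torsion := by
    intro y hy u v
    have hsymm : IsSymmSndFDerivAt ℝ (chartMap f x₀) y :=
      (hf.contDiffAt_chartMap x₀ hy).isSymmSndFDerivAt (by
        rw [minSmoothness_of_isRCLikeNormedField]
        exact WithTop.coe_le_coe.2 (OrderTop.le_top (2 : ℕ∞)))
    rw [hf.chartForm_connection x₀ hy, hf.chartForm_connection x₀ hy, hsymm u v, diffTensor_comm,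
      real_inner_comm (fderiv ℝ (chartMap f x₀) y u).1,
      real_inner_comm (fderiv ℝ (chartMap f x₀) y u).2]

theorem injective_chartForm {y : E3} (hy : y ∈ (extChartAt (𝓡 3) x₀).target) :
    Function.Injective (chartForm f x₀ y) := by
  intro v w hvw
  have h1 := eq_of_leftC_eq (hf.isTangent_fderiv x₀ hy v) (hf.isTangent_fderiv x₀ hy w) hvw
  obtain ⟨v', hv, hv'⟩ := hf.exists_pushforward x₀ hy v
  obtain ⟨w', hw, hw'⟩ := hf.exists_pushforward x₀ hy w
  rw [← hv', ← hw'] at h1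
  rw [← hv, ← hw, hf.pushforward_injective _ h1]

end IsLagrangianImmersion
end Chart

theorem exists_eq_sum_of_orthonormal {E : Type*} [NormedAddCommGroup E] [NormedSpace ℝ E]
    [FiniteDimensional ℝ E] (hE : Module.finrank ℝ E = 3) {L : E →L[ℝ] C3} {e : Fin 3 → E}
    (ho : ∀ i j, herm (L (e i)) (L (e j)) = if i = j then 1 else 0) (v : E) :
    ∃ n : Fin 3 → ℝ, v = n 0 • e 0 + n 1 • e 1 + n 2 • e 2 := by
  have hli : LinearIndependent ℝ e := by
    rw [Fintype.linearIndependent_iff]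
    intro c hc i
    have h1 : herm (L (∑ j, c j • e j)) (L (e i)) = 0 := by rw [hc]; simp [herm, bil]
    rw [Fin.sum_univ_three] at h1
    simp only [map_add, map_smul, real_smul_eq, herm_add_left, herm_smul_left, ho] at h1
    fin_cases i <;> simpa using h1
  set b := basisOfLinearIndependentOfCardEqFinrank hli (by simp [hE]) with hb
  refine ⟨fun i => b.repr v i, ?_⟩
  conv_lhs => rw [← b.sum_repr v]
  rw [Fin.sum_univ_three]
  simp [hb]

/-! ### Angles, density and the second fundamental form in the chart. -/

section Chart

variable {M : Type*} [TopologicalSpace M] [ChartedSpace (EuclideanSpace ℝ (Fin 3)) M]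
  [IsManifold (𝓡 3) ∞ M] {f : M → S3xS3}

local notation "E3" => EuclideanSpace ℝ (Fin 3)

namespace IsLagrangianImmersion

variable (hf : IsLagrangianImmersion f) (x₀ : M)
include hf

theorem leftC_pushforward {z : M} (hz : z ∈ (extChartAt (𝓡 3) x₀).source)
    (v : TangentSpace (𝓡 3) z) : leftC (incl (f z)) (pushforward (𝓡 3) f z v)
      = chartForm f x₀ (extChartAt (𝓡 3) x₀ z)
        (chartVec x₀ z v) := by
  rw [hf.pushforward_eq x₀ hz, chartForm, chartMap, (extChartAt (𝓡 3) x₀).left_inv hz]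
  rfl

/-- The real parts of the Hermitian products come from g-orthonormality, the imaginary parts vanish
by isotropy. The permutation serves to move the two equal angles to positions 0 and 1. -/
theorem isAngleFrame {z : M} (hz : z ∈ (extChartAt (𝓡 3) x₀).source) {θ : Fin 3 → ℝ}
    (hθ : AreAnglesAt f z θ) (σ : Equiv.Perm (Fin 3)) :
    ∃ e : Fin 3 → E3, IsAngleFrame (chartForm f x₀ (extChartAt (𝓡 3) x₀ z)) e
      (fun i => (Real.cos (2 * θ (σ i)) : ℂ) + (Real.sin (2 * θ (σ i)) : ℂ) * Complex.I) := by
  obtain ⟨e, ho, hP⟩ := hθ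
  have ht := fun i => pushforward_isTangent (𝓡 3) (hf.mdiff z) (e i)
  have hU := (extChartAt (𝓡 3) x₀).map_source hz
  have hL := hf.isLagrangianForm x₀
  refine ⟨fun i => chartVec x₀ z (e (σ i)), ?_⟩
  have orth : ∀ i j, herm (chartForm f x₀ (extChartAt (𝓡 3) x₀ z)
        (chartVec x₀ z (e (σ i))))
      (chartForm f x₀ (extChartAt (𝓡 3) x₀ z)
        (chartVec x₀ z (e (σ j)))) = if i = j then 1 else 0 := by
    intro i j
    apply Complex.ext
    · rw [← hf.leftC_pushforward x₀ hz, ← hf.leftC_pushforward x₀ hz,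
        ← g_eq_herm (ht _) (ht _), ho]
      simp only [σ.injective.eq_iff]
      split_ifs <;> simp
    · rw [hL.isotropic _ hU]
      split_ifs <;> simp
  refine ⟨orth, fun i => ?_, exists_eq_sum_of_orthonormal (by simp) orth⟩
  rw [← hf.leftC_pushforward x₀ hz, ← leftC_P (ht _), hP, map_add, map_smul, map_smul,
    leftC_J (ht _), real_smul_eq, real_smul_eq, smul_smul, ← add_smul]

omit hf [IsManifold (𝓡 3) ∞ M] in
theorem _root_.NearlyKahler.target_subset_closure {D : Set M} (hD : Dense D) :
    (extChartAt (𝓡 3) x₀).target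
      ⊆ closure (extChartAt (𝓡 3) x₀ '' (D ∩ (extChartAt (𝓡 3) x₀).source)) := by
  intro y hy
  rw [mem_closure_iff]
  intro O hO hyO
  have hopen := (continuousOn_extChartAt (I := 𝓡 3) x₀).isOpen_inter_preimage
    (isOpen_extChartAt_source x₀) hO
  obtain ⟨z, hz, hzD⟩ := hD.inter_open_nonempty _ hopen
    ⟨(extChartAt (𝓡 3) x₀).symm y, (extChartAt (𝓡 3) x₀).map_target hy, by
      rw [Set.mem_preimage, (extChartAt (𝓡 3) x₀).right_inv hy]; exact hyO⟩
  exact ⟨_, hz.2, z, ⟨hzD, hz.1⟩, rfl⟩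

omit hf in
/-- A smooth vector field in the chart. -/
theorem _root_.NearlyKahler.mdifferentiableAt_chart_field
    {Y : (y : M) → TangentSpace (𝓡 3) y}
    (hY : ContMDiffAt (𝓡 3) (𝓡 3).tangent ∞ (fun y => (⟨y, Y y⟩ : TangentBundle (𝓡 3) M)) x₀) :
    MDifferentiableAt (𝓡 3) 𝓘(ℝ, E3)
      (fun z => chartVec x₀ z (Y z)) x₀ := by
  have : IsManifold (𝓡 3) 1 M := IsManifold.of_le (n := ∞) (by simp)
  have h1 := ((Bundle.contMDiffAt_section x₀).1 hY).mdifferentiableAt (by simp)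
  refine h1.congr_of_eventuallyEq ?_
  filter_upwards [(chartAt E3 x₀).open_source.mem_nhds (mem_chart_source _ x₀)] with z hz
  rw [chartVec, ← TangentBundle.continuousLinearMapAt_trivializationAt hz]
  exact Bundle.Trivialization.continuousLinearMapAt_apply_of_mem (R := ℝ) _ (by simpa using hz) _

/-- The vector b is the derivative of the components of Y in the chart. It contributes a tangential
term, so h depends on Y only through its value at the point. -/
theorem mvfderiv_pushforward {Y : (y : M) → TangentSpace (𝓡 3) y}
    (hY : ContMDiffAt (𝓡 3) (𝓡 3).tangent ∞ (fun y => (⟨y, Y y⟩ : TangentBundle (𝓡 3) M)) x₀)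
    (v : TangentSpace (𝓡 3) x₀) :
    MDifferentiableAt (𝓡 3) 𝓘(ℝ, HxH) (fun y => pushforward (𝓡 3) f y (Y y)) x₀ ∧
    ∃ b : E3, mvfderiv (𝓡 3) (fun y => pushforward (𝓡 3) f y (Y y)) x₀ v
      = fderiv ℝ (fderiv ℝ (chartMap f x₀)) (extChartAt (𝓡 3) x₀ x₀)
          (chartVec x₀ x₀ v)
          (chartVec x₀ x₀ (Y x₀))
        + fderiv ℝ (chartMap f x₀) (extChartAt (𝓡 3) x₀ x₀) b := by
  have : IsManifold (𝓡 3) 1 M := IsManifold.of_le (n := ∞) (by simp)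
  set Yc : M → E3 := fun z => chartVec x₀ z (Y z) with hYc
  have hYd : MDifferentiableAt (𝓡 3) 𝓘(ℝ, E3) Yc x₀ :=
    NearlyKahler.mdifferentiableAt_chart_field x₀ hY
  have hφ : MDifferentiableAt (𝓡 3) 𝓘(ℝ, E3) (extChartAt (𝓡 3) x₀) x₀ :=
    mdifferentiableAt_extChartAt (mem_chart_source _ x₀)
  have hu : MDifferentiableAt (𝓡 3) 𝓘(ℝ, E3 × E3) (fun z => (extChartAt (𝓡 3) x₀ z, Yc z)) x₀ :=
    hφ.prodMk_space hYd
  have hy := mem_extChartAt_target (I := 𝓡 3) x₀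
  have h2 : DifferentiableAt ℝ (fderiv ℝ (chartMap f x₀)) (extChartAt (𝓡 3) x₀ x₀) :=
    ((hf.contDiffAt_chartMap x₀ hy).fderiv_right (m := 1)
      (WithTop.coe_le_coe.2 (OrderTop.le_top (2 : ℕ∞)))).differentiableAt one_ne_zero
  have hΦ : HasFDerivAt (fun p : E3 × E3 => fderiv ℝ (chartMap f x₀) p.1 p.2) _
      (extChartAt (𝓡 3) x₀ x₀, Yc x₀) :=
    (h2.hasFDerivAt.comp (extChartAt (𝓡 3) x₀ x₀, Yc x₀) hasFDerivAt_fst).clm_apply hasFDerivAt_snd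
  have heq : (fun y => pushforward (𝓡 3) f y (Y y)) =ᶠ[nhds x₀]
      fun z => fderiv ℝ (chartMap f x₀) (extChartAt (𝓡 3) x₀ z) (Yc z) := by
    filter_upwards [extChartAt_source_mem_nhds (I := 𝓡 3) x₀] with z hz
    exact hf.pushforward_eq x₀ hz _
  have h3 : mvfderiv (𝓡 3) (fun y => pushforward (𝓡 3) f y (Y y)) x₀
      = mvfderiv (𝓡 3) (fun z => fderiv ℝ (chartMap f x₀) (extChartAt (𝓡 3) x₀ z) (Yc z)) x₀ :=
    heq.mfderiv_eq
  have h4 := mvfderiv_comp_apply hu hΦ v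
  have e1 := mvfderiv_comp_apply hu (hasFDerivAt_fst (𝕜 := ℝ)) v
  have h5 : MDifferentiableAt (𝓡 3) 𝓘(ℝ, HxH)
      (fun z => fderiv ℝ (chartMap f x₀) (extChartAt (𝓡 3) x₀ z) (Yc z)) x₀ :=
    HasMFDerivAt.mdifferentiableAt
      (HasMFDerivAt.comp x₀ (g := fun p : E3 × E3 => fderiv ℝ (chartMap f x₀) p.1 p.2)
        hΦ.hasMFDerivAt hu.hasMFDerivAt)
  refine ⟨h5.congr_of_eventuallyEq heq,
    (mvfderiv (𝓡 3) (fun z => (extChartAt (𝓡 3) x₀ z, Yc z)) x₀ v).2, ?_⟩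
  rw [h3]
  refine h4.trans ?_
  have e2 : (mvfderiv (𝓡 3) (fun z => (extChartAt (𝓡 3) x₀ z, Yc z)) x₀ v).1
      = chartVec x₀ x₀ v := e1.symm
  rw [← e2]
  simp [add_comm]
  rfl

/-- The second fundamental form vanishes where it does in the chart and in the left-invariant
frame. -/
theorem secondFundamentalForm_eq_zero
    (hs : ∀ u v w, sff (chartForm f x₀) (extChartAt (𝓡 3) x₀ x₀) u v w = 0)
    (v : TangentSpace (𝓡 3) x₀) {Y : (y : M) → TangentSpace (𝓡 3) y}
    (hY : ContMDiffAt (𝓡 3) (𝓡 3).tangent ∞ (fun y => (⟨y, Y y⟩ : TangentBundle (𝓡 3) M)) x₀) :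
    secondFundamentalForm (𝓡 3) f x₀ v Y = 0 := by
  rw [secondFundamentalForm_eq_zero_iff]
  have hz := mem_extChartAt_source (I := 𝓡 3) x₀
  have hy := mem_extChartAt_target (I := 𝓡 3) x₀
  obtain ⟨hd, b, hb⟩ := hf.mvfderiv_pushforward x₀ hY v
  have htan := nabla_isTangent (𝓡 3) (hf.mdiff x₀) hd
    (fun y => pushforward_isTangent (𝓡 3) (hf.mdiff y) (Y y)) v
  set u := chartVec x₀ x₀ v with hu
  set y := chartVec x₀ x₀ (Y x₀) with hyd
  -- Vanishing of `sff` says that the covariant derivative is orthogonal to `J` of the tangent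
  -- space; in half dimension this forces it to be tangent.
  obtain ⟨c, hc⟩ := exists_eq_of_isotropic (by simp) (hf.injective_chartForm x₀ hy)
    ((hf.isLagrangianForm x₀).isotropic _ hy) (hs u y)
  obtain ⟨w, hw⟩ := exists_mfderiv_extChartAt x₀ hz (b + c)
  refine ⟨w, eq_of_leftC_eq (pushforward_isTangent (𝓡 3) (hf.mdiff x₀) w) htan ?_⟩
  rw [hf.leftC_pushforward x₀ hz, hw, map_add, hc, hf.chartForm_connection x₀ hy, nabla, hb,
    hf.pushforward_eq x₀ hz, hf.pushforward_eq x₀ hz, ← hu, ← hyd, chartForm, chartMap,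
    (extChartAt (𝓡 3) x₀).left_inv hz]
  rw [ContinuousLinearMap.comp_apply, ← map_add]
  congr 1
  abel

end IsLagrangianImmersion
end Chart

end NearlyKahler

end

theorem lemma3p5 {M : Type*} [TopologicalSpace M]
    [ChartedSpace (EuclideanSpace ℝ (Fin 3)) M] [IsManifold (𝓡 3) ∞ M]
    (f : M → NearlyKahler.S3xS3) (hf : NearlyKahler.IsLagrangianImmersion f)
    (D : Set M) (hD : Dense D) (θ : Fin 3 → M → ℝ)
    (hθ : ∀ x ∈ D, NearlyKahler.AreAnglesAt f x (fun i => θ i x))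
    (i j : Fin 3) (hij : i ≠ j)
    (heq : ∀ x ∈ D, ∃ k : ℤ, θ i x - θ j x = k * Real.pi) :
    NearlyKahler.IsTotallyGeodesic f := by
  intro x v Y hY
  obtain ⟨σ, hσ0, hσ1⟩ : ∃ σ : Equiv.Perm (Fin 3), σ 0 = i ∧ σ 1 = j := by
    have : ∀ i j : Fin 3, i ≠ j → ∃ σ : Equiv.Perm (Fin 3), σ 0 = i ∧ σ 1 = j := by decide
    exact this i j hij
  refine hf.secondFundamentalForm_eq_zero x (fun a b c => ?_) v hY
  refine (hf.isLagrangianForm x).sff_eq_zero (NearlyKahler.target_subset_closure x hD) ?_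
    (mem_extChartAt_target x) a b c
  rintro _ ⟨⟨z, ⟨hzD, hz⟩, rfl⟩, -⟩
  obtain ⟨e, F⟩ := hf.isAngleFrame x hz (hθ z hzD) σ
  refine ⟨e, _, F, ?_⟩
  obtain ⟨k, hk⟩ := heq z hzD
  -- Only 2θ enters the frame, so equality modulo π is equality of the eigenvalues.
  have h2 : 2 * θ i z = 2 * θ j z + k * (2 * Real.pi) := by linear_combination 2 * hk
  simp only [hσ0, hσ1]
  rw [h2, Real.cos_add_int_mul_two_pi, Real.sin_add_int_mul_two_pi]
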